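/- **Setting.** Let $\mathbb H_1=\mathbb R^3$ be the Heisenberg group with law $(a,b,c)(a',b',c')=(a+a',b+b',c+c'+ab')$, let $\Gamma=\{(a,b,c): a,b,c\in\mathbb Z\}$ and $M=\Gamma\backslash\mathbb H_1$, with elements $\dot x=\Gamma x$, equipped with the invariant measure that is $da\,db\,dc$ on the fundamental domain $[0,1)^3$. A function on $M$ is smooth if its $\Gamma$-periodic lift to $\mathbb H_1\cong\mathbb R^3$ is smooth. Let $R(g)f(\dot x)=f(\dot x g)$ be the right regular representation of $\mathbb H_1$ on $L^2(M)$, and for real $\lambda\ne0$ let $\pi_\lambda(a,b,c)h(u)=e^{2\pi i\lambda(c+ub)}h(u+a)$ be the Schrödinger representation on $L^2(\mathbb R)$. For $\lambda\in\mathbb Z$ let $$L^2_\lambda(M)=\{f\in L^2(M): f(\Gamma(a,b,c))=f(\Gamma(a,b,0))\,e^{2\pi i\lambda c}\},$$ where the identity is required for all $(a,b,c)$ for some representative of the class $f$. **Theorem.** The spaces $L^2_\lambda(M)$ are closed and $R$-invariant, and $L^2(M)=\bigoplus^\perp_{\lambda\in\mathbb Z}L^2_\lambda(M)$ (orthogonal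 Hilbert sum). Every $f\in L^2(M)$ is the $L^2$-convergent sum $f=\sum_{\lambda\in\mathbb Z} f_\lambda$ with $f_\lambda\in L^2_\lambda(M)$ given for almost every $(a,b,c)$ by $f_\lambda(\Gamma(a,b,c))=e^{2\pi i\lambda c}\int_0^1 f(\Gamma(a,b,t))e^{-2\pi i\lambda t}\,dt$. 1. For $\omega\in\mathbb Z^2$ the formula $\chi_\omega(\Gamma(a,b,c))=e^{2\pi i(\omega_1a+\omega_2b)}$ gives a well defined smooth function on $M$, and $L^2_0(M)=\bigoplus^\perp_{\omega\in\mathbb Z^2}\mathbb C\chi_\omega$, where each $\mathbb C\chi_\omega$ is $R$-invariant and irreducible. 2. Let $\lambda\in\mathbb Z\setminus\{0\}$. For $h\in\mathcal S(\mathbb R)$, $q\in\mathbb Z$ and $x=(a,b,c)$ put $$\mathrm{BWZ}_{\lambda,q}(h)(\dot x)=\frac{\sqrt{|\lambda|}}{\lambda}\sum_{k\in\mathbb Z}e^{-2\pi i qk/\lambda}\,e^{2\pi i(\lambda c+kb)}\,h\!\left(\tfrac k\lambda+a\right).$$ (a) The series converges absolutely, $\mathrm{BWZ}_{\lambda,q}(h)$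 is a well defined smooth function on $M$ which belongs to $L^2_\lambda(M)$, and $\mathrm{BWZ}_{\lambda,\lambda k_1+q}(h)=\mathrm{BWZ}_{\lambda,q}(h)$ for all $k_1\in\mathbb Z$; so $q$ may be taken in $\mathbb Z/\lambda\mathbb Z$. (b) For each $q\in\mathbb Z/\lambda\mathbb Z$, $\mathrm{BWZ}_{\lambda,q}$ extends uniquely, among bounded linear maps from $L^2(\mathbb R)$ to $L^2(M)$, to a linear isometry $\mathrm{BWZ}_{\lambda,q}:L^2(\mathbb R)\to L^2(M)$ with values in $L^2_\lambda(M)$ (that is, a unitary map onto its range). (c) For all $q_0,q\in\mathbb Z$ and $\dot x=\Gamma(a,b,c)$, $$\mathrm{BWZ}_{\lambda,q_0}(h)\big(\dot x(\tfrac q\lambda,0,0)\big)=e^{-2\pi i qb}e^{2\pi i q_0q/\lambda}\,\mathrm{BWZ}_{\lambda,q_0}(h)(\dot x),\qquad \mathrm{BWZ}_{\lambda,q_0}(h)\big(\dot x(0,\tfrac q\lambda,0)\big)=e^{2\pi i qa}\,\mathrm{BWZ}_{\lambda,q_0-q}(h)(\dot x),$$ everywhere for $h\in\mathcal S(\mathbb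 R)$, and for almost every $(a,b,c)$ for $h\in L^2(\mathbb R)$. 3. Let $\lambda\in\mathbb Z\setminus\{0\}$. The subspaces $L^2_{\lambda,q}(M)=\mathrm{BWZ}_{\lambda,q}(L^2(\mathbb R))$, $q\in\mathbb Z/\lambda\mathbb Z$, are closed and $R$-invariant, and $L^2_\lambda(M)=\bigoplus^\perp_{q\in\mathbb Z/\lambda\mathbb Z}L^2_{\lambda,q}(M)$. Moreover $\pi_\lambda$ is irreducible, and $\mathrm{BWZ}_{\lambda,q}\,\pi_\lambda(g)=R(g)\,\mathrm{BWZ}_{\lambda,q}$ for all $g\in\mathbb H_1$, so that $R$ restricted to $L^2_{\lambda,q}(M)$ is unitarily equivalent to $\pi_\lambda$ with intertwiner $\mathrm{BWZ}_{\lambda,q}$. -/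

import Mathlib

open MeasureTheory
open scoped SchwartzMap ContDiff ENNReal

noncomputable section

namespace HeisNil

/-! ## The Heisenberg group -/

/-- The Heisenberg group, realised as `ℝ³` with coordinates `(a, b, c)`. -/
@[ext]
structure Heis where
  a : ℝ
  b : ℝ
  c : ℝ

namespace Heis

instance : Mul Heis := ⟨fun x y => ⟨x.a + y.a, x.b + y.b, x.c + y.c + x.a * y.b⟩⟩
instance : One Heis := ⟨⟨0, 0, 0⟩⟩
instance : Inv Heis := ⟨fun x => ⟨-x.a, -x.b, -x.c + x.a * x.b⟩⟩

@[simp] theorem mul_a (x y : Heis) : (x * y).a = x.a + y.a := rfl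
@[simp] theorem mul_b (x y : Heis) : (x * y).b = x.b + y.b := rfl
@[simp] theorem mul_c (x y : Heis) : (x * y).c = x.c + y.c + x.a * y.b := rfl
@[simp] theorem one_a : (1 : Heis).a = 0 := rfl
@[simp] theorem one_b : (1 : Heis).b = 0 := rfl
@[simp] theorem one_c : (1 : Heis).c = 0 := rfl
@[simp] theorem inv_a (x : Heis) : (x⁻¹).a = -x.a := rfl
@[simp] theorem inv_b (x : Heis) : (x⁻¹).b = -x.b := rfl
@[simp] theorem inv_c (x : Heis) : (x⁻¹).c = -x.c + x.a * x.b := rfl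

instance : Group Heis :=
  Group.ofLeftAxioms
    (fun x y z => by ext <;> simp <;> ring)
    (fun x => by ext <;> simp)
    (fun x => by ext <;> simp)

/-- The identification of the Heisenberg group with `ℝ × ℝ × ℝ`. -/
def equivProd : Heis ≃ ℝ × ℝ × ℝ where
  toFun x := (x.a, x.b, x.c)
  invFun p := ⟨p.1, p.2.1, p.2.2⟩
  left_inv _ := rfl
  right_inv _ := rfl

/-- The point `(a, b, c)` of the Heisenberg group attached to a triple of reals. -/
def ofProd (p : ℝ × ℝ × ℝ) : Heis := ⟨p.1, p.2.1, p.2.2⟩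

/-- The Borel structure, transported from `ℝ × ℝ × ℝ`. -/
instance : MeasurableSpace Heis := MeasurableSpace.comap equivProd inferInstance

theorem measurable_equivProd : Measurable equivProd := comap_measurable _

theorem measurable_ofProd : Measurable ofProd := by
  rintro s ⟨t, ht, rfl⟩
  exact ht

theorem measurable_to {X : Type*} [MeasurableSpace X] {f : X → Heis}
    (ha : Measurable fun x => (f x).a) (hb : Measurable fun x => (f x).b)
    (hc : Measurable fun x => (f x).c) : Measurable f :=
  measurable_ofProd.comp (ha.prodMk (hb.prodMk hc))

theorem measurable_a : Measurable Heis.a := measurable_equivProd.fst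
theorem measurable_b : Measurable Heis.b := measurable_equivProd.snd.fst
theorem measurable_c : Measurable Heis.c := measurable_equivProd.snd.snd

/-- The Haar measure `da db dc`. -/
def haar : Measure Heis := (volume : Measure (ℝ × ℝ × ℝ)).map ofProd

theorem mp_ofProd : MeasurePreserving ofProd volume haar := ⟨measurable_ofProd, rfl⟩

theorem mp_equivProd : MeasurePreserving equivProd haar volume := by
  refine ⟨measurable_equivProd, ?_⟩
  rw [haar, Measure.map_map measurable_equivProd measurable_ofProd]
  exact Measure.map_id

/-- Left translations preserve `da db dc`. -/
theorem mp_mul_left (g : Heis) : MeasurePreserving (fun x => g * x) haar haar := by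
  have h : MeasurePreserving
      (fun p : ℝ × ℝ × ℝ => (g.a + p.1, (g.b + p.2.1, (g.c + g.a * p.2.1) + p.2.2)))
      volume volume := by
    refine (measurePreserving_add_left volume g.a).prod
      (MeasurePreserving.skew_product (μa := (volume : Measure ℝ)) (μb := volume)
        (μc := (volume : Measure ℝ)) (μd := volume) (measurePreserving_add_left volume g.b)
        (g := fun b c => (g.c + g.a * b) + c) ?_ ?_)
    · unfold Function.uncurry; fun_prop
    · exact Filter.Eventually.of_forall fun b =>
        (measurePreserving_add_left volume (g.c + g.a * b)).map_eq
  have h2 := (mp_ofProd.comp h).comp mp_equivProd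
  convert h2 using 1
  funext x
  ext <;> simp [ofProd, equivProd]
  ring

/-- Right translations preserve `da db dc`. -/
theorem mp_mul_right (g : Heis) : MeasurePreserving (fun x => x * g) haar haar := by
  have h : MeasurePreserving
      (fun p : ℝ × ℝ × ℝ => (p.1 + g.a, (p.2.1 + g.b, p.2.2 + (g.c + p.1 * g.b))))
      volume volume := by
    refine MeasurePreserving.skew_product (μa := (volume : Measure ℝ)) (μb := volume)
        (μc := (volume : Measure (ℝ × ℝ))) (μd := volume) (measurePreserving_add_right volume g.a)
        (g := fun a p => (p.1 + g.b, p.2 + (g.c + a * g.b))) ?_ ?_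
    · unfold Function.uncurry; fun_prop
    · exact Filter.Eventually.of_forall fun a =>
        ((measurePreserving_add_right volume g.b).prod
          (measurePreserving_add_right volume (g.c + a * g.b))).map_eq
  have h2 := (mp_ofProd.comp h).comp mp_equivProd
  convert h2 using 1
  funext x
  ext <;> simp [ofProd, equivProd]
  ring

end Heis

/-! ## The nilmanifold `M = Γ \ ℍ₁` -/

/-- The discrete subgroup `Γ` of points with integer coordinates. -/
def Gamma : Subgroup Heis where
  carrier := {x | ∃ m n p : ℤ, x = ⟨m, n, p⟩}
  mul_mem' := by
    rintro _ _ ⟨m, n, p, rfl⟩ ⟨m', n', p', rfl⟩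
    exact ⟨m + m', n + n', p + p' + m * n', by ext <;> simp⟩
  one_mem' := ⟨0, 0, 0, by ext <;> simp⟩
  inv_mem' := by
    rintro _ ⟨m, n, p, rfl⟩
    exact ⟨-m, -n, -p + m * n, by ext <;> simp⟩

/-- `M = Γ \ ℍ₁`, the space of right cosets `Γ x`. -/
def M : Type := Quotient (QuotientGroup.rightRel Gamma)

/-- The projection `x ↦ ẋ = Γ x`. -/
def mk (x : Heis) : M := Quotient.mk (QuotientGroup.rightRel Gamma) x

theorem mk_eq_mk {x y : Heis} : mk x = mk y ↔ y * x⁻¹ ∈ Gamma :=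
  Quotient.eq.trans QuotientGroup.rightRel_apply

/-- The right action `ẋ ↦ ẋ g` of the Heisenberg group on `M`. -/
def rmul (g : Heis) (m : M) : M :=
  Quotient.map (fun x => x * g)
    (fun x y h => by
      have h' : y * x⁻¹ ∈ Gamma := QuotientGroup.rightRel_apply.1 h
      exact QuotientGroup.rightRel_apply.2 (by simpa [mul_assoc] using h')) m

@[simp] theorem rmul_mk (g x : Heis) : rmul g (mk x) = mk (x * g) := rfl

theorem mk_surjective : Function.Surjective mk := Quotient.mk_surjective

/-- The quotient (Borel) structure on `M`. -/
instance : MeasurableSpace M := MeasurableSpace.map mk inferInstance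

theorem measurable_mk : Measurable mk := fun _ h => h

/-- The fundamental domain `[0,1)³`. -/
def cube : Set Heis :=
  {x | x.a ∈ Set.Ico (0 : ℝ) 1 ∧ x.b ∈ Set.Ico (0 : ℝ) 1 ∧ x.c ∈ Set.Ico (0 : ℝ) 1}

/-- The invariant measure `dẋ` on `M`, which is `da db dc` on the fundamental domain `[0,1)³`. -/
def muM : Measure M := (Heis.haar.restrict cube).map mk

theorem measurableSet_cube : MeasurableSet cube :=
  ((Heis.measurable_a measurableSet_Ico).inter
    ((Heis.measurable_b measurableSet_Ico).inter (Heis.measurable_c measurableSet_Ico)))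

instance : Countable Gamma := by
  have : Function.Surjective (fun t : ℤ × ℤ × ℤ =>
      (⟨⟨t.1, t.2.1, t.2.2⟩, t.1, t.2.1, t.2.2, rfl⟩ : Gamma)) := by
    rintro ⟨_, m, n, p, rfl⟩
    exact ⟨(m, n, p), rfl⟩
  exact this.countable

instance : MeasurableConstSMul Gamma Heis :=
  ⟨fun g => (Heis.mp_mul_left (g : Heis)).measurable⟩

instance : SMulInvariantMeasure Gamma Heis Heis.haar :=
  ⟨fun g _ hs => (Heis.mp_mul_left (g : Heis)).measure_preimage hs.nullMeasurableSet⟩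

theorem isFundamentalDomain_cube : IsFundamentalDomain Gamma cube Heis.haar := by
  refine IsFundamentalDomain.mk' measurableSet_cube.nullMeasurableSet fun x => ?_
  refine ⟨⟨⟨(-⌊x.a⌋ : ℤ), (-⌊x.b⌋ : ℤ), (-⌊x.c + (-⌊x.a⌋ : ℤ) * x.b⌋ : ℤ)⟩, _, _, _, rfl⟩,
    ?_, ?_⟩
  · have h (t : ℝ) : ((-⌊t⌋ : ℤ) : ℝ) + t ∈ Set.Ico (0 : ℝ) 1 := by
      push_cast
      constructor
      · linarith [Int.floor_le t]
      · linarith [Int.lt_floor_add_one t]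
    refine ⟨h _, h _, ?_⟩
    have := h (x.c + (-⌊x.a⌋ : ℤ) * x.b)
    rw [← add_assoc] at this
    exact this
  · rintro ⟨_, m, n, p, rfl⟩ ⟨ha, hb, hc⟩
    have key (k : ℤ) (t : ℝ) (h : (k : ℝ) + t ∈ Set.Ico (0 : ℝ) 1) : k = -⌊t⌋ := by
      have : ⌊t⌋ = -k := by
        rw [Int.floor_eq_iff]
        push_cast
        constructor <;> linarith [h.1, h.2]
      omega
    have ea := key m x.a ha
    have eb := key n x.b hb
    subst ea eb
    have ec := key p (x.c + (-⌊x.a⌋ : ℤ) * x.b) (by rw [← add_assoc]; exact hc)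
    subst ec
    rfl

/-- Right translations preserve `dẋ`. -/
theorem mp_rmul (g : Heis) : MeasurePreserving (rmul g) muM muM := by
  have hm : Measurable (rmul g) := fun s hs =>
    (Heis.mp_mul_right g).measurable (measurable_mk hs)
  refine ⟨hm, Measure.ext fun s hs => ?_⟩
  have hA := measurable_mk hs
  rw [Measure.map_apply hm hs, muM, Measure.map_apply measurable_mk (hm hs),
    Measure.map_apply measurable_mk hs, Measure.restrict_apply hA,
    Measure.restrict_apply (measurable_mk (hm hs))]
  have hF : IsFundamentalDomain Gamma ((fun x => x * g⁻¹) ⁻¹' cube) Heis.haar :=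
    isFundamentalDomain_cube.preimage_of_equiv
      (Heis.mp_mul_right g⁻¹).quasiMeasurePreserving (e := id) Function.bijective_id
      (fun γ x => mul_assoc (γ : Heis) x g⁻¹)
  have h1 : mk ⁻¹' (rmul g ⁻¹' s) ∩ cube
      = (fun x => x * g) ⁻¹' (mk ⁻¹' s ∩ (fun x => x * g⁻¹) ⁻¹' cube) := by
    ext x
    simp
  rw [h1, (Heis.mp_mul_right g).measure_preimage
    (hA.inter ((Heis.mp_mul_right g⁻¹).measurable measurableSet_cube)).nullMeasurableSet]
  refine hF.measure_set_eq isFundamentalDomain_cube hA fun γ => ?_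
  ext x
  have : mk (γ • x) = mk x :=
    mk_eq_mk.2 (by
      have : x * ((γ : Heis) * x)⁻¹ = (γ : Heis)⁻¹ := by group
      change x * ((γ : Heis) * x)⁻¹ ∈ Gamma
      rw [this]
      exact Gamma.inv_mem γ.2)
  simp [this]

/-- `f` is a smooth function on `M`: its `Γ`-periodic lift is smooth on `ℍ₁ = ℝ³`. -/
def SmoothOnM (f : M → ℂ) : Prop :=
  ContDiff ℝ ∞ fun p : ℝ × ℝ × ℝ => f (mk (Heis.ofProd p))

/-- The function on `M` obtained by evaluating `φ` at a representative. When `φ` is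
`Γ`-periodic this is the function `ẋ ↦ φ x`. -/
def onM (φ : Heis → ℂ) : M → ℂ := fun m => φ (Quotient.out m)

/-- `φ` is `Γ`-periodic, i.e. it descends to a well defined function on `M`. -/
def IsPeriodic (φ : Heis → ℂ) : Prop := ∀ γ ∈ Gamma, ∀ x, φ (γ * x) = φ x

/-! ## The spaces `L²(M)`, `L²(ℝ)` and the unitary representations -/

/-- The Hilbert space `L²(M)`. -/
abbrev L2M : Type := Lp ℂ 2 muM

/-- The Hilbert space `L²(ℝ)`. -/
abbrev L2R : Type := Lp ℂ 2 (volume : Measure ℝ)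

/-- The right regular representation `R(g) f (ẋ) = f (ẋ g)` on `L²(M)`, as a homomorphism into
the unitary group. -/
def regRep : Heis →* (L2M ≃ₗᵢ[ℂ] L2M) :=
  let U (g : Heis) : L2M →ₗᵢ[ℂ] L2M := Lp.compMeasurePreservingₗᵢ ℂ (rmul g) (mp_rmul g)
  have hmul (g g' : Heis) (f : L2M) : U (g * g') f = U g (U g' f) := by
    refine Lp.ext ?_
    refine (Lp.coeFn_compMeasurePreserving f (mp_rmul (g * g'))).trans ?_
    refine .trans ?_ (Lp.coeFn_compMeasurePreserving (U g' f) (mp_rmul g)).symm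
    refine .trans ?_ ((mp_rmul g).quasiMeasurePreserving.ae_eq_comp
      (Lp.coeFn_compMeasurePreserving f (mp_rmul g')).symm)
    refine .of_eq (funext fun m => ?_)
    obtain ⟨x, rfl⟩ := mk_surjective m
    simp [mul_assoc]
  have hone (f : L2M) : U 1 f = f := by
    refine Lp.ext ((Lp.coeFn_compMeasurePreserving f (mp_rmul 1)).trans ?_)
    refine .of_eq (funext fun m => ?_)
    obtain ⟨x, rfl⟩ := mk_surjective m
    simp
  { toFun := fun g =>
      { toLinearEquiv := LinearEquiv.ofLinearMap (U g).toLinearMap (U g⁻¹).toLinearMap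
          (LinearMap.ext fun f => by
            change U g (U g⁻¹ f) = f
            rw [← hmul, mul_inv_cancel, hone])
          (LinearMap.ext fun f => by
            change U g⁻¹ (U g f) = f
            rw [← hmul, inv_mul_cancel, hone])
        norm_map' := (U g).norm_map }
    map_one' := LinearIsometryEquiv.ext hone
    map_mul' := fun g g' => LinearIsometryEquiv.ext (hmul g g') }

/-- The defining formula of the right regular representation. -/
theorem coeFn_regRep (g : Heis) (f : L2M) :
    (regRep g f : M → ℂ) =ᵐ[muM] fun m => (f : M → ℂ) (rmul g m) :=
  Lp.coeFn_compMeasurePreserving f (mp_rmul g)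

/-- The factor `e^{2πi l (c + u b)}` of the Schrödinger representation. -/
def phase (l : ℝ) (g : Heis) (u : ℝ) : ℂ :=
  Complex.exp (2 * Real.pi * Complex.I * l * (g.c + u * g.b))

theorem norm_phase (l : ℝ) (g : Heis) (u : ℝ) : ‖phase l g u‖ = 1 := by
  have : phase l g u = Complex.exp (((2 * Real.pi * l * (g.c + u * g.b) : ℝ) : ℂ) * Complex.I) := by
    unfold phase
    push_cast
    ring_nf
  rw [this, Complex.norm_exp_ofReal_mul_I]

theorem memLp_schrodinger (l : ℝ) (g : Heis) (f : L2R) :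
    MemLp (fun u : ℝ => phase l g u * (f : ℝ → ℂ) (u + g.a)) 2 volume := by
  have h := (Lp.memLp f).comp_measurePreserving (measurePreserving_add_right volume g.a)
  refine h.of_le (AEStronglyMeasurable.mul ?_ h.1) (.of_forall fun u => ?_)
  · exact Continuous.aestronglyMeasurable (by unfold phase; fun_prop)
  · simp [norm_phase]

/-- The operator `f ↦ (u ↦ e^{2πi l (c + u b)} f (u + a))` on `L²(ℝ)`. -/
def schrodingerOp (l : ℝ) (g : Heis) : L2R →ₗᵢ[ℂ] L2R where
  toFun f := (memLp_schrodinger l g f).toLp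
  map_add' f f' := by
    rw [← MemLp.toLp_add, MemLp.toLp_eq_toLp_iff]
    filter_upwards [(measurePreserving_add_right volume g.a).quasiMeasurePreserving.ae_eq_comp
      (Lp.coeFn_add f f')] with u hu
    simp only [Function.comp_apply, Pi.add_apply] at hu ⊢
    rw [hu, mul_add]
  map_smul' z f := by
    rw [RingHom.id_apply, ← MemLp.toLp_const_smul, MemLp.toLp_eq_toLp_iff]
    filter_upwards [(measurePreserving_add_right volume g.a).quasiMeasurePreserving.ae_eq_comp
      (Lp.coeFn_smul z f)] with u hu
    simp only [Function.comp_apply, Pi.smul_apply, smul_eq_mul] at hu ⊢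
    rw [hu]
    ring
  norm_map' f := by
    change ‖(memLp_schrodinger l g f).toLp‖ = ‖f‖
    rw [Lp.norm_toLp, Lp.norm_def]
    congr 1
    rw [← eLpNorm_comp_measurePreserving (Lp.aestronglyMeasurable f)
      (measurePreserving_add_right volume g.a)]
    exact eLpNorm_congr_norm_ae (.of_forall fun u => by simp [norm_phase])

theorem coeFn_schrodingerOp (l : ℝ) (g : Heis) (f : L2R) :
    (schrodingerOp l g f : ℝ → ℂ) =ᵐ[volume]
      fun u => phase l g u * (f : ℝ → ℂ) (u + g.a) :=
  (memLp_schrodinger l g f).coeFn_toLp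

theorem schrodingerOp_mul (l : ℝ) (g g' : Heis) (f : L2R) :
    schrodingerOp l (g * g') f = schrodingerOp l g (schrodingerOp l g' f) := by
  refine Lp.ext ?_
  filter_upwards [coeFn_schrodingerOp l (g * g') f,
    coeFn_schrodingerOp l g (schrodingerOp l g' f),
    (measurePreserving_add_right volume g.a).quasiMeasurePreserving.ae_eq_comp
      (coeFn_schrodingerOp l g' f)] with u h1 h2 h3
  simp only [Function.comp_apply] at h3
  rw [h1, h2, h3, ← mul_assoc, Heis.mul_a, add_assoc]
  congr 1
  unfold phase
  rw [← Complex.exp_add]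
  congr 1
  simp only [Heis.mul_c, Heis.mul_b]
  push_cast
  ring

theorem schrodingerOp_one (l : ℝ) (f : L2R) : schrodingerOp l 1 f = f := by
  refine Lp.ext ?_
  filter_upwards [coeFn_schrodingerOp l 1 f] with u h
  rw [h]
  simp [phase]

/-- The Schrödinger representation `π_l (a,b,c) h (u) = e^{2πi l (c + u b)} h (u + a)` on `L²(ℝ)`,
as a homomorphism into the unitary group. -/
def schrodinger (l : ℝ) : Heis →* (L2R ≃ₗᵢ[ℂ] L2R) where
  toFun g :=
    { toLinearEquiv := LinearEquiv.ofLinearMap (schrodingerOp l g).toLinearMap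
        (schrodingerOp l g⁻¹).toLinearMap
        (LinearMap.ext fun f => by
          change schrodingerOp l g (schrodingerOp l g⁻¹ f) = f
          rw [← schrodingerOp_mul, mul_inv_cancel, schrodingerOp_one])
        (LinearMap.ext fun f => by
          change schrodingerOp l g⁻¹ (schrodingerOp l g f) = f
          rw [← schrodingerOp_mul, inv_mul_cancel, schrodingerOp_one])
      norm_map' := (schrodingerOp l g).norm_map }
  map_one' := LinearIsometryEquiv.ext (schrodingerOp_one l)
  map_mul' g g' := LinearIsometryEquiv.ext (schrodingerOp_mul l g g')

/-- The defining formula of the Schrödinger representation. -/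
theorem coeFn_schrodinger (l : ℝ) (g : Heis) (f : L2R) :
    (schrodinger l g f : ℝ → ℂ) =ᵐ[volume]
      fun u => phase l g u * (f : ℝ → ℂ) (u + g.a) :=
  coeFn_schrodingerOp l g f

section Abstract

variable {E : Type*} [NormedAddCommGroup E] [InnerProductSpace ℂ E]

/-- The subspace `V` is stable under the representation `ρ`. -/
def IsInvariant (ρ : Heis →* (E ≃ₗᵢ[ℂ] E)) (V : Submodule ℂ E) : Prop :=
  ∀ g, ∀ f ∈ V, ρ g f ∈ V

/-- `ρ` acts irreducibly on the subspace `V`: `V` is invariant, non-zero, and has no closed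
invariant subspaces except `0` and itself. -/
def IsIrreducibleOn (ρ : Heis →* (E ≃ₗᵢ[ℂ] E)) (V : Submodule ℂ E) : Prop :=
  IsInvariant ρ V ∧ V ≠ ⊥ ∧
    ∀ W : Submodule ℂ E, W ≤ V → IsClosed (W : Set E) → IsInvariant ρ W → W = ⊥ ∨ W = V

/-- `W` is the orthogonal Hilbert direct sum of the closed subspaces `V i`. -/
def IsOrthogonalDecomposition {ι : Type*} (V : ι → Submodule ℂ E) (W : Submodule ℂ E) : Prop :=
  (∀ i, IsClosed (V i : Set E)) ∧
    OrthogonalFamily ℂ (fun i => V i) (fun i => (V i).subtypeₗᵢ) ∧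
    W = (⨆ i, V i).topologicalClosure

end Abstract

/-! ## Central Fourier modes, characters and the Berezin–Weil–Zak transform -/

/-- `L²_l(M)`: the classes in `L²(M)` with a representative `F` such that
`F (Γ(a,b,c)) = F (Γ(a,b,0)) e^{2πi l c}`. -/
def centralMode (l : ℤ) : Submodule ℂ L2M where
  carrier := {f | ∃ F : M → ℂ, (f : M → ℂ) =ᵐ[muM] F ∧ ∀ a b c : ℝ,
    F (mk ⟨a, b, c⟩) = F (mk ⟨a, b, 0⟩) * Complex.exp (2 * Real.pi * Complex.I * l * c)}
  add_mem' := by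
    rintro f f' ⟨F, hF, h⟩ ⟨F', hF', h'⟩
    refine ⟨F + F', (Lp.coeFn_add f f').trans (hF.add hF'), fun a b c => ?_⟩
    simp only [Pi.add_apply]
    rw [h a b c, h' a b c, add_mul]
  zero_mem' := ⟨0, Lp.coeFn_zero _ _ _, by simp⟩
  smul_mem' := by
    rintro z f ⟨F, hF, h⟩
    refine ⟨z • F, (Lp.coeFn_smul z f).trans (hF.const_smul z), fun a b c => ?_⟩
    change z * F _ = z * F _ * _
    rw [h a b c]
    ring

/-- `(a,b,c) ↦ e^{2πi (w₁ a + w₂ b)}` on the Heisenberg group. -/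
def chiLift (w : ℤ × ℤ) (x : Heis) : ℂ :=
  Complex.exp (2 * Real.pi * Complex.I * (w.1 * x.a + w.2 * x.b))

/-- The character `χ_w` on `M`. -/
def chi (w : ℤ × ℤ) : M → ℂ := onM (chiLift w)

/-- The `k`-th term of the series defining the Berezin–Weil–Zak transform at `(a,b,c)`. -/
def bwzTerm (l q : ℤ) (h : 𝓢(ℝ, ℂ)) (x : Heis) (k : ℤ) : ℂ :=
  Complex.exp (-(2 * Real.pi * Complex.I * q * (k / l))) *
    Complex.exp (2 * Real.pi * Complex.I * (l * x.c + k * x.b)) * h ((k : ℝ) / l + x.a)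

/-- The series of the Berezin–Weil–Zak transform, as a function on the Heisenberg group. -/
def bwzLift (l q : ℤ) (h : 𝓢(ℝ, ℂ)) (x : Heis) : ℂ :=
  ((Real.sqrt |(l : ℝ)| / l : ℝ) : ℂ) * ∑' k : ℤ, bwzTerm l q h x k

/-- The Berezin–Weil–Zak transform of a Schwartz function, as a function on `M`. -/
def bwz (l q : ℤ) (h : 𝓢(ℝ, ℂ)) : M → ℂ := onM (bwzLift l q h)

end HeisNil

end

open HeisNil

/-! The centre of the Heisenberg group acts on `M` through a circle, so Fourier series in `c` split
`L²(M)` into the modes `centralMode l`. Two different modes are eigenspaces of a suitable central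
translation with different eigenvalues, hence orthogonal (`inner_centralMode`). Every completeness
claim rests on the exponentials of the cube: as measure spaces `M` and the cube agree, so a function
whose Fourier coefficients there all vanish is zero (`eq_zero_of_fourier`), and a closed subspace is
exhausted once nothing nonzero in it is orthogonal to the pieces (`eq_closure_iSup_of_orthogonal`).

For `l ≠ 0` the transform, read on the cube, is a Fourier series in `b` whose coefficients are the
samples `h (k / l + a)`. Terms with different `k` are orthogonal, and the intervals `k / l + [0,1)`
cover the line exactly `|l|` times, which the factor `√|l| / l` compensates; this is the isometry
`norm_bwz_toLp`. Left multiplication by `Γ` only reindexes the series, the decay of `h` gives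
smoothness, and a comparison of terms gives the intertwining relation (`bwz_schrodinger`). Density
of Schwartz functions carries the identities to `L²(ℝ)`.

Translation by `1 / l` in `a`, followed by multiplication by `e^{2πib}`, is the scalar `e^{2πiq/l}`
on the `q`-th range, so different ranges are orthogonal (`inner_bwzIso`). They fill the mode because
a finite Fourier sum over `q` isolates one index `k` when `h` lives on a unit interval
(`sum_bwz_eq_cellMode`). The Schrödinger representation is irreducible because vanishing of all
matrix coefficients of `f` and `g` forces, by Fourier uniqueness, the product of `g` with the
conjugate of every translate of `f` to vanish; integrating over the translations gives `f = 0` or `g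
= 0`. -/

noncomputable section

namespace HeisNil

/-! ### Hilbert space criteria for density and orthogonality. -/

section Abstract

variable {E : Type*} [NormedAddCommGroup E] [InnerProductSpace ℂ E]

/-- A closed subspace `W` in which only `0` is orthogonal to all `V i ≤ W` is the closed span
of the `V i`. -/
theorem eq_closure_iSup_of_orthogonal [CompleteSpace E] {ι : Type*} (V : ι → Submodule ℂ E) (W : Submodule ℂ E)
    (hW : IsClosed (W : Set E)) (hV : ∀ i, V i ≤ W)
    (h0 : ∀ f ∈ W, (∀ i, ∀ v ∈ V i, inner ℂ v f = 0) → f = 0) :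
    W = (⨆ i, V i).topologicalClosure := by
  refine le_antisymm (fun f hf => ?_)
    (Submodule.topologicalClosure_minimal _ (iSup_le hV) hW)
  set K := (⨆ i, V i).topologicalClosure with hK
  have : CompleteSpace K := (Submodule.isClosed_topologicalClosure _).completeSpace_coe
  have hKW : K ≤ W := Submodule.topologicalClosure_minimal _ (iSup_le hV) hW
  obtain ⟨y, hy, z, hz, rfl⟩ := K.exists_add_mem_mem_orthogonal f
  have hzW : z ∈ W := by simpa using W.sub_mem hf (hKW hy)
  have : z = 0 := h0 z hzW fun i v hv =>
    (Submodule.mem_orthogonal K z).1 hz v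
      ((Submodule.le_topologicalClosure _) (Submodule.mem_iSup_of_mem i hv))
  simpa [this] using hy

/-- Eigenvectors of an isometry for distinct eigenvalues of modulus one are orthogonal. -/
theorem inner_eq_zero_of_eigen {T : E → E} (hT : ∀ x y, inner ℂ (T x) (T y) = inner ℂ x y)
    {z w : ℂ} (hz : ‖z‖ = 1) (hzw : z ≠ w) {x y : E} (hx : T x = z • x) (hy : T y = w • y) :
    inner ℂ x y = 0 := by
  have h := hT x y
  rw [hx, hy, inner_smul_left, inner_smul_right] at h
  have hzz : starRingEnd ℂ z * z = 1 := by
    rw [mul_comm, Complex.mul_conj, Complex.normSq_eq_norm_sq, hz]; simp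
  have h2 : (w - z) * inner ℂ x y = 0 := by
    linear_combination z * h - (w * inner ℂ x y) * hzz
  exact (mul_eq_zero.1 h2).resolve_left (sub_ne_zero.2 hzw.symm)

end Abstract

/-! ### The fundamental domain -/

theorem onM_mk {φ : Heis → ℂ} (h : IsPeriodic φ) (x : Heis) : onM φ (mk x) = φ x := by
  have h1 : mk (Quotient.out (mk x)) = mk x := Quotient.out_eq (mk x)
  have h2 := mk_eq_mk.1 h1.symm
  have := h _ h2 x
  simpa [onM] using this

theorem mk_mul_left {γ : Heis} (hγ : γ ∈ Gamma) (x : Heis) : mk (γ * x) = mk x := by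
  refine mk_eq_mk.2 ?_
  have : x * (γ * x)⁻¹ = γ⁻¹ := by group
  rw [this]
  exact Gamma.inv_mem hγ

/-- The representative of `Γ x` in the cube `[0,1)³`. -/
def reduce (x : Heis) : Heis :=
  ⟨Int.fract x.a, Int.fract x.b, Int.fract (x.c - ⌊x.a⌋ * x.b)⟩

theorem reduce_mul_left {γ : Heis} (hγ : γ ∈ Gamma) (x : Heis) : reduce (γ * x) = reduce x := by
  obtain ⟨m, n, p, rfl⟩ := hγ
  ext
  · simp [reduce]
  · simp [reduce]
  · simp only [reduce, Heis.mul_a, Heis.mul_b, Heis.mul_c, Int.floor_intCast_add]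
    rw [Int.fract_eq_fract]
    -- The real term `m * b` from the group law cancels against the new floor of `a`; only this
    -- integer remains.
    refine ⟨p - (m + ⌊x.a⌋) * n, ?_⟩
    push_cast
    ring

theorem mk_reduce (x : Heis) : mk (reduce x) = mk x := by
  have : reduce x = ⟨(-⌊x.a⌋ : ℤ), (-⌊x.b⌋ : ℤ), (-⌊x.c - ⌊x.a⌋ * x.b⌋ : ℤ)⟩ * x := by
    ext <;> simp only [reduce, Int.fract, Heis.mul_a, Heis.mul_b, Heis.mul_c] <;> push_cast <;> ring
  rw [this, mk_mul_left ⟨_, _, _, rfl⟩]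

theorem reduce_of_mem_cube {x : Heis} (hx : x ∈ cube) : reduce x = x := by
  obtain ⟨ha, hb, hc⟩ := hx
  have : ⌊x.a⌋ = 0 := Int.floor_eq_zero_iff.2 ha
  ext
  · simpa [reduce] using Int.fract_eq_self.2 ha
  · simpa [reduce] using Int.fract_eq_self.2 hb
  · simpa [reduce, this] using Int.fract_eq_self.2 hc

theorem measurable_reduce : Measurable reduce := by
  refine Heis.measurable_to ?_ ?_ ?_
  · exact measurable_fract.comp Heis.measurable_a
  · exact measurable_fract.comp Heis.measurable_b
  · refine measurable_fract.comp (Heis.measurable_c.sub (Measurable.mul ?_ Heis.measurable_b))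
    exact (measurable_from_top (f := fun n : ℤ => (n : ℝ))).comp
      (Int.measurable_floor.comp Heis.measurable_a)

/-- The representative in the cube `[0,1)³` of a point of `M`. -/
def rep (m : M) : Heis := reduce (Quotient.out m)

theorem rep_mk (x : Heis) : rep (mk x) = reduce x := by
  have h1 : mk (Quotient.out (mk x)) = mk x := Quotient.out_eq (mk x)
  have h2 := reduce_mul_left (mk_eq_mk.1 h1.symm) x
  simpa [rep] using h2

@[simp] theorem mk_rep (m : M) : mk (rep m) = m := by
  rw [rep, mk_reduce]
  exact Quotient.out_eq m

theorem measurable_rep : Measurable rep := fun s hs => by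
  change MeasurableSet (mk ⁻¹' (rep ⁻¹' s))
  have : mk ⁻¹' (rep ⁻¹' s) = reduce ⁻¹' s := by
    ext x; simp [rep_mk]
  rw [this]
  exact measurable_reduce hs

theorem rep_mem_cube (m : M) : rep m ∈ cube :=
  ⟨⟨Int.fract_nonneg _, Int.fract_lt_one _⟩, ⟨Int.fract_nonneg _, Int.fract_lt_one _⟩,
    ⟨Int.fract_nonneg _, Int.fract_lt_one _⟩⟩

/-- Lebesgue measure on `[0,1)`. -/
abbrev unitMeasure : Measure ℝ := volume.restrict (Set.Ico 0 1)

instance : IsProbabilityMeasure unitMeasure := ⟨by simp⟩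

/-- Lebesgue measure on `[0,1)³`. -/
abbrev cellMeasure : Measure (ℝ × ℝ × ℝ) := unitMeasure.prod (unitMeasure.prod unitMeasure)

/-- The point of `M` with the given coordinates. -/
abbrev toM (p : ℝ × ℝ × ℝ) : M := mk (Heis.ofProd p)

theorem measurable_toM : Measurable toM := measurable_mk.comp Heis.measurable_ofProd

theorem mp_toM : MeasurePreserving toM cellMeasure muM := by
  refine ⟨measurable_toM, ?_⟩
  have h1 : cellMeasure = volume.restrict (Heis.ofProd ⁻¹' cube) := by
    rw [cellMeasure, unitMeasure, Measure.prod_restrict, Measure.prod_restrict]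
    rfl
  rw [h1, muM, ← (Heis.mp_ofProd.restrict_preimage measurableSet_cube).map_eq,
    Measure.map_map measurable_mk Heis.measurable_ofProd]
  rfl

theorem ae_cell_mem : ∀ᵐ p ∂cellMeasure, Heis.ofProd p ∈ cube := by
  have h1 : cellMeasure = volume.restrict (Heis.ofProd ⁻¹' cube) := by
    rw [cellMeasure, unitMeasure, Measure.prod_restrict, Measure.prod_restrict]
    rfl
  rw [h1]
  exact ae_restrict_mem (Heis.measurable_ofProd measurableSet_cube)

theorem ae_cell_rep : ∀ᵐ p ∂cellMeasure, rep (toM p) = Heis.ofProd p :=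
  ae_cell_mem.mono fun p hp => by rw [rep_mk, reduce_of_mem_cube hp]

instance : IsProbabilityMeasure muM := by
  rw [← mp_toM.map_eq]
  exact Measure.isProbabilityMeasure_map measurable_toM.aemeasurable

/-- A property of almost every point of `M` holds at almost every point of `ℝ³`. -/
theorem ae_toM {P : M → Prop} (h : ∀ᵐ m ∂muM, P m) : ∀ᵐ p : ℝ × ℝ × ℝ, P (toM p) := by
  obtain ⟨N, hsub, hNm, hN⟩ := exists_measurable_superset_of_null (ae_iff.1 h)
  -- The preimage of `N` is `Γ`-invariant, so it is null as soon as its part in the fundamental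
  -- domain is.
  have h0 : Heis.haar (mk ⁻¹' N) = 0 := by
    refine isFundamentalDomain_cube.measure_zero_of_invariant _ (fun γ => ?_) ?_
    · ext x
      rw [Set.mem_smul_set_iff_inv_smul_mem]
      have : mk (γ⁻¹ • x) = mk x := mk_mul_left (Gamma.inv_mem γ.2) x
      simp [this]
    · rw [muM, Measure.map_apply measurable_mk hNm,
        Measure.restrict_apply (measurable_mk hNm)] at hN
      exact hN
  refine ae_iff.2 (measure_mono_null (t := toM ⁻¹' N) (fun p hp => hsub hp) ?_)
  have := Heis.mp_ofProd.measure_preimage (measurable_mk hNm).nullMeasurableSet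
  rw [h0] at this
  exact this

theorem measurable_of_lift {X : Type*} [MeasurableSpace X] {f : M → X}
    (h : Measurable fun x => f (mk x)) : Measurable f := fun _ hs => h hs

/-! ### Fourier modes on the fundamental domain -/

/-- `t ↦ e^{2πi n t}`. -/
def expo (n : ℤ) (t : ℝ) : ℂ := Complex.exp (2 * Real.pi * Complex.I * n * t)

theorem norm_expo (n : ℤ) (t : ℝ) : ‖expo n t‖ = 1 := by
  have : expo n t = Complex.exp (((2 * Real.pi * n * t : ℝ) : ℂ) * Complex.I) := by
    unfold expo; push_cast; ring_nf
  rw [this, Complex.norm_exp_ofReal_mul_I]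

@[fun_prop] theorem continuous_expo (n : ℤ) : Continuous (expo n) := by unfold expo; fun_prop

theorem expo_add (n : ℤ) (s t : ℝ) : expo n (s + t) = expo n s * expo n t := by
  unfold expo; rw [← Complex.exp_add]; push_cast; ring_nf

theorem expo_int (n m : ℤ) : expo n m = 1 :=
  Complex.exp_eq_one_iff.2 ⟨n * m, by push_cast; ring⟩

theorem expo_add_int (n : ℤ) (t : ℝ) (m : ℤ) : expo n (t + m) = expo n t := by
  rw [expo_add, expo_int, mul_one]

theorem expo_fract (n : ℤ) (t : ℝ) : expo n (Int.fract t) = expo n t := by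
  conv_rhs => rw [← Int.fract_add_floor t]
  rw [expo_add_int]

theorem expo_mul_expo (n m : ℤ) (t : ℝ) : expo n t * expo m t = expo (n + m) t := by
  unfold expo; rw [← Complex.exp_add]; push_cast; ring_nf

theorem conj_expo (n : ℤ) (t : ℝ) : starRingEnd ℂ (expo n t) = expo (-n) t := by
  unfold expo; rw [← Complex.exp_conj]; simp [Complex.conj_ofNat]

theorem expo_apply_zero (n : ℤ) : expo n 0 = 1 := by simp [expo]

@[simp] theorem expo_zero (t : ℝ) : expo 0 t = 1 := by simp [expo]

theorem fourier_coe_eq_expo (n : ℤ) (t : ℝ) : fourier n (t : UnitAddCircle) = expo n t := by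
  rw [fourier_coe_apply]; simp [expo]

theorem integral_expo (n : ℤ) : ∫ t, expo n t ∂unitMeasure = if n = 0 then 1 else 0 := by
  split_ifs with h
  · simp [h]
  · rw [integral_Ico_eq_integral_Ioc, ← intervalIntegral.integral_of_le zero_le_one]
    have hc : (2 * Real.pi * Complex.I * n : ℂ) ≠ 0 :=
      mul_ne_zero Complex.two_pi_I_ne_zero (Int.cast_ne_zero.2 h)
    have h1 := expo_int n 1
    simp only [expo, Int.cast_one, Complex.ofReal_one, mul_one] at h1
    have := integral_exp_mul_complex (a := 0) (b := 1) hc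
    simp only [expo]
    rw [this]
    simp [h1]

/-- The function equal to `φ(a) e^{2πi(kb+lc)}` on the cube. -/
def cellMode (k l : ℤ) (φ : ℝ → ℂ) (m : M) : ℂ :=
  φ (rep m).a * (expo k (rep m).b * expo l (rep m).c)

theorem measurable_cellMode (k l : ℤ) {φ : ℝ → ℂ} (hφ : Measurable φ) :
    Measurable (cellMode k l φ) := by
  unfold cellMode
  exact (hφ.comp (Heis.measurable_a.comp measurable_rep)).mul
    (((continuous_expo k).measurable.comp (Heis.measurable_b.comp measurable_rep)).mul
      ((continuous_expo l).measurable.comp (Heis.measurable_c.comp measurable_rep)))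

theorem norm_cellMode (k l : ℤ) (φ : ℝ → ℂ) (m : M) : ‖cellMode k l φ m‖ = ‖φ (rep m).a‖ := by
  simp [cellMode, norm_expo]

theorem memLp_cellMode (k l : ℤ) {φ : ℝ → ℂ} (hφ : Measurable φ) {C : ℝ}
    (hC : ∀ t ∈ Set.Ico (0 : ℝ) 1, ‖φ t‖ ≤ C) (p : ℝ≥0∞) : MemLp (cellMode k l φ) p muM :=
  MemLp.of_bound (measurable_cellMode k l hφ).aestronglyMeasurable C
    (.of_forall fun m => by rw [norm_cellMode]; exact hC _ (rep_mem_cube m).1)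

/-- Reduction to the cube alters `c` by an integer and by `⌊a⌋ * b`, and the latter does not depend
on `c`. So a cell mode, although it may jump across the faces of the cube, has exact central
equivariance everywhere. -/
theorem cellMode_central (k l : ℤ) (φ : ℝ → ℂ) (a b c : ℝ) :
    cellMode k l φ (mk ⟨a, b, c⟩) = cellMode k l φ (mk ⟨a, b, 0⟩) * expo l c := by
  simp only [cellMode, rep_mk, reduce, expo_fract]
  have : c - ⌊a⌋ * b = (0 - ⌊a⌋ * b) + c := by ring
  rw [this, expo_add]
  ring

theorem integral_comp_of_measurePreserving {X Y E : Type*} [MeasurableSpace X] [MeasurableSpace Y]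
    [NormedAddCommGroup E] [NormedSpace ℝ E] {μ : Measure X} {ν : Measure Y} {g : X → Y}
    (hg : MeasurePreserving g μ ν) {f : Y → E} (hf : AEStronglyMeasurable f ν) :
    ∫ x, f (g x) ∂μ = ∫ y, f y ∂ν := by
  rw [← hg.map_eq] at hf ⊢
  exact (integral_map hg.measurable.aemeasurable hf).symm

theorem integral_M {E : Type*} [NormedAddCommGroup E] [NormedSpace ℝ E] {f : M → E}
    (hf : AEStronglyMeasurable f muM) : ∫ m, f m ∂muM = ∫ p, f (toM p) ∂cellMeasure :=
  (integral_comp_of_measurePreserving mp_toM hf).symm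

/-- Orthogonality to cell modes becomes vanishing of Fourier coefficients on the cube. -/
theorem inner_cellMode {k l : ℤ} {φ : ℝ → ℂ} (hφ : MemLp (cellMode k l φ) 2 muM) (f : L2M) :
    inner ℂ (hφ.toLp) f = ∫ p, starRingEnd ℂ (φ p.1) * ((expo (-k) p.2.1 * expo (-l) p.2.2) *
      (f : M → ℂ) (toM p)) ∂cellMeasure := by
  rw [L2.inner_def]
  have h1 : ∫ m, inner ℂ ((hφ.toLp : M → ℂ) m) ((f : M → ℂ) m) ∂muM
      = ∫ m, inner ℂ (cellMode k l φ m) ((f : M → ℂ) m) ∂muM :=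
    integral_congr_ae (hφ.coeFn_toLp.mono fun m hm => by simp only [hm])
  rw [h1, integral_M (hφ.1.inner (Lp.aestronglyMeasurable f))]
  refine integral_congr_ae (ae_cell_rep.mono fun p hp => ?_)
  simp only [cellMode, RCLike.inner_apply, hp, map_mul, conj_expo, Heis.ofProd]
  ring

theorem inner_cellMode_cellMode {k k' l l' : ℤ} {φ ψ : ℝ → ℂ}
    (hφ : MemLp (cellMode k l φ) 2 muM) (hψ : MemLp (cellMode k' l' ψ) 2 muM) :
    inner ℂ hφ.toLp hψ.toLp = (∫ a, starRingEnd ℂ (φ a) * ψ a ∂unitMeasure) *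
      ((if k = k' then 1 else 0) * (if l = l' then 1 else 0)) := by
  rw [inner_cellMode]
  have h1 : ∀ᵐ p ∂cellMeasure, starRingEnd ℂ (φ p.1) * ((expo (-k) p.2.1 *
      expo (-l) p.2.2) * (hψ.toLp : M → ℂ) (toM p)) =
      (starRingEnd ℂ (φ p.1) * ψ p.1) * (expo (k' - k) p.2.1 * expo (l' - l) p.2.2) := by
    filter_upwards [mp_toM.quasiMeasurePreserving.ae hψ.coeFn_toLp, ae_cell_rep] with p hp hr
    rw [hp, cellMode, hr, sub_eq_neg_add, sub_eq_neg_add, ← expo_mul_expo, ← expo_mul_expo]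
    simp only [Heis.ofProd]
    ring
  rw [integral_congr_ae h1, integral_prod_mul (fun a => starRingEnd ℂ (φ a) * ψ a)
    (fun p : ℝ × ℝ => expo (k' - k) p.1 * expo (l' - l) p.2),
    integral_prod_mul (fun a => expo (k' - k) a) (fun a => expo (l' - l) a), integral_expo,
    integral_expo]
  simp only [sub_eq_zero, eq_comm (a := k'), eq_comm (a := l')]

/-! ### Completeness of the exponentials on the cube, transported from the torus. -/

/-- The representative in `(0,1]` of a point of the circle. -/
def circleRep (t : UnitAddCircle) : ℝ := AddCircle.measurableEquivIoc 1 0 t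

theorem coe_circleRep (t : UnitAddCircle) : (circleRep t : UnitAddCircle) = t :=
  (AddCircle.measurableEquivIoc 1 0).symm_apply_apply t

theorem mp_circleRep : MeasurePreserving circleRep volume unitMeasure := by
  have h := (measurePreserving_subtype_coe measurableSet_Ioc).comp
    (AddCircle.measurePreserving_equivIoc 1 (a := 0))
  have h0 : unitMeasure = volume.restrict (Set.Ioc (0 : ℝ) (0 + 1)) := by
    rw [unitMeasure, restrict_Ico_eq_restrict_Ioc, zero_add]
  rw [h0]
  exact h

/-- The normalized Haar measure of the torus. -/
abbrev torusMeasure (d : Type*) [Fintype d] : Measure (UnitAddTorus d) :=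
  Measure.pi fun _ => AddCircle.haarAddCircle

/-- The Fourier basis is used for normalized Haar measure, the splitting into coordinates for
`volume`; circumference one makes them equal. -/
theorem torusMeasure_eq_volume (d : Type*) [Fintype d] : torusMeasure d = volume := by
  have : (AddCircle.haarAddCircle : Measure UnitAddCircle) = volume := by
    rw [AddCircle.volume_eq_smul_haarAddCircle]; simp
  rw [torusMeasure, this]
  rfl

theorem eq_zero_of_mFourierCoeff {d : Type*} [Fintype d] (g : Lp ℂ 2 (torusMeasure d))
    (h : ∀ n, ∫ t, UnitAddTorus.mFourier (-n) t * g t ∂torusMeasure d = 0) : g = 0 := by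
  have : UnitAddTorus.mFourierBasis.repr g = 0 := by
    ext n
    rw [UnitAddTorus.mFourierBasis_repr]
    exact h n
  simpa using this

/-- The representative in `(0,1]³` of a point of the torus. -/
def torusRep (t : UnitAddTorus (Fin 3)) : ℝ × ℝ × ℝ :=
  (circleRep (t 0), circleRep (t 1), circleRep (t 2))

theorem mp_torusRep : MeasurePreserving torusRep (torusMeasure _) cellMeasure := by
  rw [torusMeasure_eq_volume]
  have h1 := volume_preserving_piFinSuccAbove (fun _ : Fin 3 => UnitAddCircle) 0
  have h2 := volume_preserving_piFinTwo (fun _ : Fin 2 => UnitAddCircle)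
  exact (mp_circleRep.prod ((mp_circleRep.prod mp_circleRep).comp h2)).comp h1

/-- A function of `L²(M)` all of whose Fourier coefficients on the cube vanish is zero. -/
theorem eq_zero_of_fourier (f : L2M)
    (h : ∀ j k l : ℤ, ∫ p, starRingEnd ℂ (expo j p.1) * ((expo (-k) p.2.1 * expo (-l) p.2.2) *
      (f : M → ℂ) (toM p)) ∂cellMeasure = 0) : f = 0 := by
  -- Pulling back along this measure preserving map is isometric, so it suffices that the pullback
  -- to the torus vanishes.
  have hs := mp_toM.comp mp_torusRep
  obtain ⟨g, hg, hgf⟩ : ∃ g : Lp ℂ 2 (torusMeasure (Fin 3)),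
      ‖g‖ = ‖f‖ ∧ g =ᵐ[torusMeasure _] (f : M → ℂ) ∘ (toM ∘ torusRep) :=
    ⟨Lp.compMeasurePreservingₗᵢ ℂ _ hs f, LinearIsometry.norm_map _ f,
      Lp.coeFn_compMeasurePreserving f hs⟩
  suffices g = 0 by
    rw [this, norm_zero] at hg
    exact norm_eq_zero.1 hg.symm
  refine eq_zero_of_mFourierCoeff g fun n => ?_
  · have h3 : ∫ t, UnitAddTorus.mFourier (-n) t * (g : UnitAddTorus (Fin 3) → ℂ) t ∂torusMeasure _
        = ∫ t, (fun p : ℝ × ℝ × ℝ => starRingEnd ℂ (expo (n 0) p.1) *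
          ((expo (-n 1) p.2.1 * expo (-n 2) p.2.2) * (f : M → ℂ) (toM p))) (torusRep t) ∂torusMeasure _ := by
      refine integral_congr_ae (hgf.mono fun t ht => ?_)
      have ht' : (g : UnitAddTorus (Fin 3) → ℂ) t = (f : M → ℂ) (toM (torusRep t)) := ht
      have hF (n : ℤ) (s : UnitAddCircle) : fourier n s = expo n (circleRep s) := by
        conv_lhs => rw [← coe_circleRep s]
        exact fourier_coe_eq_expo _ _
      simp only [ht', UnitAddTorus.mFourier, ContinuousMap.coe_mk, Fin.prod_univ_three, hF,
        conj_expo, torusRep, Pi.neg_apply]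
      ring
    have hm : AEStronglyMeasurable (fun p : ℝ × ℝ × ℝ => starRingEnd ℂ (expo (n 0) p.1) *
        ((expo (-n 1) p.2.1 * expo (-n 2) p.2.2) * (f : M → ℂ) (toM p))) cellMeasure := by
      refine AEStronglyMeasurable.mul (Continuous.aestronglyMeasurable ?_)
        (AEStronglyMeasurable.mul (Continuous.aestronglyMeasurable ?_)
          ((Lp.aestronglyMeasurable f).comp_measurePreserving mp_toM))
      · exact Complex.continuous_conj.comp ((continuous_expo _).comp continuous_fst)
      · fun_prop
    rw [h3, ← h (n 0) (n 1) (n 2)]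
    exact integral_comp_of_measurePreserving mp_torusRep hm

/-! ### The projections onto the central Fourier modes -/

/-- The action `(ẋ, t) ↦ ẋ (0,0,t)` of the centre. -/
def centralAct (q : M × ℝ) : M := rmul ⟨0, 0, q.2⟩ q.1

theorem centralAct_mk (a b c t : ℝ) : centralAct (mk ⟨a, b, c⟩, t) = mk ⟨a, b, c + t⟩ := by
  change mk _ = _
  congr 1
  ext <;> simp

theorem measurable_centralAct : Measurable centralAct := by
  have : centralAct = fun q => mk (rep q.1 * ⟨0, 0, q.2⟩) := by
    funext q
    conv_lhs => rw [centralAct, ← mk_rep q.1, rmul_mk]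
  rw [this]
  have hr : Measurable fun q : M × ℝ => rep q.1 := measurable_rep.comp measurable_fst
  refine measurable_mk.comp (Heis.measurable_to ?_ ?_ ?_)
  · simp only [Heis.mul_a, add_zero]
    exact Heis.measurable_a.comp hr
  · simp only [Heis.mul_b, add_zero]
    exact Heis.measurable_b.comp hr
  · simp only [Heis.mul_c, mul_zero, add_zero]
    exact (Heis.measurable_c.comp hr).add measurable_snd

/-- For each fixed `t` the map is a right translation, so shearing `M` over the `t`-axis preserves
the product measure; then `t` is forgotten. -/
theorem mp_centralAct : MeasurePreserving centralAct (muM.prod unitMeasure) muM := by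
  have h1 : MeasurePreserving (fun q : ℝ × M => (q.1, centralAct (q.2, q.1)))
      (unitMeasure.prod muM) (unitMeasure.prod muM) :=
    MeasurePreserving.skew_product (g := fun t m => centralAct (m, t)) (MeasurePreserving.id _)
      (measurable_centralAct.comp measurable_swap)
      (.of_forall fun t => (mp_rmul ⟨0, 0, t⟩).map_eq)
  exact (measurePreserving_snd.comp h1).comp Measure.measurePreserving_swap

/-- The `l`-th Fourier component of `f` along the centre. -/
def centralCoeff (l : ℤ) (f : M → ℂ) (m : M) : ℂ :=
  ∫ t, f (centralAct (m, t)) * expo (-l) t ∂unitMeasure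

theorem periodic_central (f : M → ℂ) (a b : ℝ) :
    Function.Periodic (fun t : ℝ => f (mk ⟨a, b, t⟩)) 1 := fun t => by
  have h : (⟨a, b, t + 1⟩ : Heis) = ⟨(0 : ℤ), (0 : ℤ), (1 : ℤ)⟩ * ⟨a, b, t⟩ := by
    ext <;> simp [add_comm]
  simp only [h, mk_mul_left (γ := ⟨(0 : ℤ), (0 : ℤ), (1 : ℤ)⟩) ⟨_, _, _, rfl⟩]

theorem periodic_expo (l : ℤ) : Function.Periodic (expo l) 1 := fun t => by
  simpa using expo_add_int l t 1

/-- Substituting `c + t` and using periodicity pulls the phase out of the integral. This needs no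
integrability, so `centralCoeff` is a representative obeying the defining law of the mode at every
point. -/
theorem centralCoeff_mk (l : ℤ) (f : M → ℂ) (a b c : ℝ) :
    centralCoeff l f (mk ⟨a, b, c⟩) =
      expo l c * ∫ t in (0 : ℝ)..1, f (mk ⟨a, b, t⟩) * expo (-l) t := by
  have hper := (periodic_central f a b).mul (periodic_expo (-l))
  rw [centralCoeff, unitMeasure, integral_Ico_eq_integral_Ioc,
    ← intervalIntegral.integral_of_le zero_le_one]
  have h1 (t : ℝ) : f (centralAct (mk ⟨a, b, c⟩, t)) * expo (-l) t =
      expo l c * (fun t => f (mk ⟨a, b, t⟩) * expo (-l) t) (c + t) := by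
    have h2 := expo_mul_expo l (-l) c
    rw [add_neg_cancel, expo_zero] at h2
    simp only [centralAct_mk, expo_add]
    linear_combination (-(f (mk ⟨a, b, c + t⟩) * expo (-l) t)) * h2
  simp only [h1, intervalIntegral.integral_const_mul]
  congr 1
  rw [intervalIntegral.integral_comp_add_left (fun t => f (mk ⟨a, b, t⟩) * expo (-l) t)]
  simpa using hper.intervalIntegral_add_eq c 0

theorem memLp_centralAct (f : L2M) :
    MemLp (fun q => (f : M → ℂ) (centralAct q)) 2 (muM.prod unitMeasure) :=
  (Lp.memLp f).comp_measurePreserving mp_centralAct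

theorem ae_integrable_centralAct (f : L2M) :
    ∀ᵐ m ∂muM, Integrable (fun t => (f : M → ℂ) (centralAct (m, t))) unitMeasure :=
  ((memLp_centralAct f).integrable (by norm_num)).prod_right_ae

theorem integrable_mul_expo {μ : Measure ℝ} {g : ℝ → ℂ} (hg : Integrable g μ) (l : ℤ) :
    Integrable (fun t => g t * expo l t) μ :=
  hg.mul_bdd (c := 1) (continuous_expo l).aestronglyMeasurable
    (.of_forall fun t => (norm_expo l t).le)

theorem enorm_integral_le_eLpNorm_two {X : Type*} [MeasurableSpace X] {μ : Measure X}
    [IsProbabilityMeasure μ] {g : X → ℂ} (hg : AEStronglyMeasurable g μ) :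
    ‖∫ x, g x ∂μ‖ₑ ≤ eLpNorm g 2 μ := by
  refine (enorm_integral_le_lintegral_enorm g).trans ?_
  rw [← eLpNorm_one_eq_lintegral_enorm]
  exact eLpNorm_le_eLpNorm_of_exponent_le (by norm_num) hg

theorem eLpNorm_two_sq {X : Type*} [MeasurableSpace X] (μ : Measure X) (g : X → ℂ) :
    eLpNorm g 2 μ ^ 2 = ∫⁻ x, ‖g x‖ₑ ^ 2 ∂μ := by
  have := eLpNorm_nnreal_pow_eq_lintegral (f := g) (μ := μ) (p := 2) (by norm_num)
  simpa using this

theorem aestronglyMeasurable_centralCoeff (l : ℤ) (f : L2M) :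
    AEStronglyMeasurable (centralCoeff l f) muM :=
  AEStronglyMeasurable.integral_prod_right' (f := fun q : M × ℝ =>
    (f : M → ℂ) (centralAct q) * expo (-l) q.2) ((memLp_centralAct f).1.mul
      ((continuous_expo _).measurable.comp measurable_snd).aestronglyMeasurable)

/-- On each orbit the integral is at most the `L²` norm, the orbit having mass one; `mp_centralAct`
then evaluates the integral over all orbits. -/
theorem eLpNorm_centralCoeff_le (l : ℤ) (f : L2M) :
    eLpNorm (centralCoeff l f) 2 muM ≤ eLpNorm f 2 muM := by
  have hm : AEStronglyMeasurable (fun q : M × ℝ => (f : M → ℂ) (centralAct q) * expo (-l) q.2)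
      (muM.prod unitMeasure) := (memLp_centralAct f).1.mul
      ((continuous_expo _).measurable.comp measurable_snd).aestronglyMeasurable
  rw [← eLpNorm_comp_measurePreserving (Lp.aestronglyMeasurable f) mp_centralAct,
    ← ENNReal.pow_le_pow_left_iff (two_ne_zero), eLpNorm_two_sq, eLpNorm_two_sq]
  have h1 : ∫⁻ q, ‖((f : M → ℂ) ∘ centralAct) q‖ₑ ^ 2 ∂(muM.prod unitMeasure) =
      ∫⁻ m, ∫⁻ t, ‖(f : M → ℂ) (centralAct (m, t))‖ₑ ^ 2 ∂unitMeasure ∂muM :=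
    lintegral_prod _ (((memLp_centralAct f).1.enorm).pow_const 2)
  rw [h1]
  refine lintegral_mono_ae ?_
  filter_upwards [ae_integrable_centralAct f] with m hfm
  have h2 := enorm_integral_le_eLpNorm_two (integrable_mul_expo hfm (-l)).1
  refine (pow_le_pow_left' h2 2).trans ?_
  rw [eLpNorm_two_sq]
  refine lintegral_mono fun t => ?_
  rw [enorm_mul, ← ofReal_norm (expo _ _), norm_expo]
  simp

theorem memLp_centralCoeff (l : ℤ) (f : L2M) : MemLp (centralCoeff l f) 2 muM :=
  ⟨aestronglyMeasurable_centralCoeff l f,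
    (eLpNorm_centralCoeff_le l f).trans_lt (Lp.eLpNorm_lt_top f)⟩

/-- If `f = F` almost everywhere then this holds along almost every central orbit. -/
theorem ae_ae_central {f F : M → ℂ} (h : f =ᵐ[muM] F) :
    ∀ᵐ m ∂muM, ∀ᵐ t ∂unitMeasure, f (centralAct (m, t)) = F (centralAct (m, t)) :=
  Measure.ae_ae_of_ae_prod (mp_centralAct.quasiMeasurePreserving.ae_eq_comp h)

theorem centralCoeff_congr {f F : M → ℂ} (h : f =ᵐ[muM] F) (l : ℤ) :
    centralCoeff l f =ᵐ[muM] centralCoeff l F :=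
  (ae_ae_central h).mono fun _ hm => integral_congr_ae (hm.mono fun t ht => by simp only [ht])

/-- The projection of `L²(M)` onto the central mode `l`. -/
def centralProj (l : ℤ) : L2M →L[ℂ] L2M :=
  LinearMap.mkContinuous
    { toFun := fun f => (memLp_centralCoeff l f).toLp
      map_add' := fun f g => by
        rw [← MemLp.toLp_add, MemLp.toLp_eq_toLp_iff]
        refine (centralCoeff_congr (Lp.coeFn_add f g) l).trans ?_
        filter_upwards [ae_integrable_centralAct f, ae_integrable_centralAct g] with m hf hg
        simp only [centralCoeff, Pi.add_apply, add_mul]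
        exact integral_add (integrable_mul_expo hf _) (integrable_mul_expo hg _)
      map_smul' := fun z f => by
        rw [RingHom.id_apply, ← MemLp.toLp_const_smul, MemLp.toLp_eq_toLp_iff]
        refine (centralCoeff_congr (Lp.coeFn_smul z f) l).trans (.of_eq ?_)
        funext m
        simp only [centralCoeff, Pi.smul_apply, smul_eq_mul, mul_assoc]
        exact integral_const_mul _ _ } 1 fun f => by
    rw [one_mul]
    change ‖(memLp_centralCoeff l f).toLp‖ ≤ ‖f‖
    rw [Lp.norm_toLp, Lp.norm_def]
    exact ENNReal.toReal_mono (Lp.eLpNorm_ne_top f) (eLpNorm_centralCoeff_le l f)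

theorem coeFn_centralProj (l : ℤ) (f : L2M) :
    (centralProj l f : M → ℂ) =ᵐ[muM] centralCoeff l f :=
  (memLp_centralCoeff l f).coeFn_toLp

theorem mem_centralMode_iff {l : ℤ} {f : L2M} : f ∈ centralMode l ↔
    ∃ F : M → ℂ, (f : M → ℂ) =ᵐ[muM] F ∧
      ∀ a b c : ℝ, F (mk ⟨a, b, c⟩) = F (mk ⟨a, b, 0⟩) * expo l c := Iff.rfl

theorem central_translate {l : ℤ} {F : M → ℂ}
    (hF : ∀ a b c : ℝ, F (mk ⟨a, b, c⟩) = F (mk ⟨a, b, 0⟩) * expo l c) (m : M) (t : ℝ) :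
    F (centralAct (m, t)) = expo l t * F m := by
  obtain ⟨⟨a, b, c⟩, rfl⟩ := mk_surjective m
  rw [centralAct_mk, hF a b (c + t), hF a b c, expo_add]
  ring

theorem centralProj_mem (l : ℤ) (f : L2M) : centralProj l f ∈ centralMode l :=
  mem_centralMode_iff.2 ⟨_, coeFn_centralProj l f, fun a b c => by
    rw [centralCoeff_mk, centralCoeff_mk l f a b 0]
    rw [expo_apply_zero]
    ring⟩

theorem centralProj_of_mem {l l' : ℤ} {f : L2M} (hf : f ∈ centralMode l) :
    centralProj l' f = if l = l' then f else 0 := by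
  obtain ⟨F, hfF, hF⟩ := mem_centralMode_iff.1 hf
  have h1 (m : M) : centralCoeff l' F m = (if l = l' then 1 else 0) * F m := by
    have (t : ℝ) : F (centralAct (m, t)) * expo (-l') t = expo (l - l') t * F m := by
      rw [central_translate hF, sub_eq_add_neg, ← expo_mul_expo]
      ring
    simp only [centralCoeff, this]
    rw [integral_mul_const, integral_expo]
    simp only [sub_eq_zero]
  refine Lp.ext ((coeFn_centralProj l' f).trans ((centralCoeff_congr hfF l').trans ?_))
  split_ifs with h
  · refine .trans (.of_eq ?_) hfF.symm
    funext m
    simp [h1, h]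
  · refine .trans (.of_eq ?_) (Lp.coeFn_zero _ _ _).symm
    funext m
    simp [h1, h]

/-- A condition on some representative is not visibly closed; being fixed by the continuous map
`centralProj` is. -/
theorem isClosed_centralMode (l : ℤ) : IsClosed (centralMode l : Set L2M) := by
  have : (centralMode l : Set L2M) = {f | centralProj l f = f} := by
    ext f
    refine ⟨fun hf => by simp [centralProj_of_mem hf], fun hf => ?_⟩
    rw [SetLike.mem_coe, ← show centralProj l f = f from hf]
    exact centralProj_mem l f
  rw [this]
  exact isClosed_eq (centralProj l).continuous continuous_id

theorem regRep_central {l : ℤ} {f : L2M} (hf : f ∈ centralMode l) (t : ℝ) :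
    regRep ⟨0, 0, t⟩ f = expo l t • f := by
  obtain ⟨F, hfF, hF⟩ := mem_centralMode_iff.1 hf
  refine Lp.ext ((coeFn_regRep _ f).trans ?_)
  filter_upwards [(mp_rmul ⟨0, 0, t⟩).quasiMeasurePreserving.ae_eq_comp hfF, hfF,
    Lp.coeFn_smul (expo l t) f] with m h1 h2 h3
  simp only [Function.comp_apply] at h1
  rw [h1, h3, Pi.smul_apply, h2]
  exact central_translate hF m t

theorem inner_centralMode {l l' : ℤ} (h : l ≠ l') {f g : L2M} (hf : f ∈ centralMode l)
    (hg : g ∈ centralMode l') : inner ℂ f g = 0 := by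
  have hn : ((l : ℝ) - l') ≠ 0 := sub_ne_zero.2 (Int.cast_injective.ne h)
  -- Half a period of the frequency `l - l'`: the ratio of the two eigenvalues is `e^{πi} = -1`.
  set t : ℝ := 1 / (2 * (l - l')) with ht
  refine inner_eq_zero_of_eigen (LinearIsometryEquiv.inner_map_map (regRep ⟨0, 0, t⟩))
    (norm_expo l t) (fun he => ?_) (regRep_central hf t) (regRep_central hg t)
  have h1 : expo (l - l') t = -1 := by
    have : (2 * Real.pi * Complex.I * ((l - l' : ℤ) : ℂ) * (t : ℂ)) = Real.pi * Complex.I := by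
      have h2 : (((l - l' : ℤ) : ℂ)) * (t : ℂ) = 1 / 2 := by
        have : ((l : ℝ) - l') * t = 1 / 2 := by rw [ht]; field_simp
        have h3 := congrArg (fun x : ℝ => (x : ℂ)) this
        push_cast at h3 ⊢
        exact h3
      linear_combination (2 * Real.pi * Complex.I) * h2
    rw [expo, this, Complex.exp_pi_mul_I]
  rw [sub_eq_add_neg, ← expo_mul_expo, he, expo_mul_expo, add_neg_cancel, expo_zero] at h1
  norm_num at h1

theorem cellMode_mem (k l : ℤ) {φ : ℝ → ℂ} (hφ : MemLp (cellMode k l φ) 2 muM) :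
    hφ.toLp ∈ centralMode l :=
  mem_centralMode_iff.2 ⟨_, hφ.coeFn_toLp, cellMode_central k l φ⟩

theorem memLp_cellMode_expo (j k l : ℤ) : MemLp (cellMode k l (expo j)) 2 muM :=
  memLp_cellMode k l (continuous_expo j).measurable (C := 1) (fun t _ => (norm_expo j t).le) 2

/-- An element of the mode `l` orthogonal to all exponentials of the mode `l` is zero. -/
theorem eq_zero_of_mem_centralMode {l : ℤ} {f : L2M} (hf : f ∈ centralMode l)
    (h : ∀ j k : ℤ, inner ℂ (memLp_cellMode_expo j k l).toLp f = 0) : f = 0 := by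
  refine eq_zero_of_fourier f fun j k l' => ?_
  rw [← inner_cellMode (memLp_cellMode_expo j k l')]
  rcases eq_or_ne l' l with rfl | hl
  · exact h j k
  · exact inner_centralMode hl (cellMode_mem _ _ _) hf

theorem orthogonalFamily_centralMode :
    OrthogonalFamily ℂ (fun l => centralMode l) (fun l => (centralMode l).subtypeₗᵢ) :=
  fun _ _ h f g => inner_centralMode h f.2 g.2

theorem top_eq_closure_centralMode :
    (⊤ : Submodule ℂ L2M) = (⨆ l, centralMode l).topologicalClosure := by
  refine eq_closure_iSup_of_orthogonal _ _ isClosed_univ (fun _ => le_top) fun f _ hf => ?_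
  refine eq_zero_of_fourier f fun j k l => ?_
  rw [← inner_cellMode (memLp_cellMode_expo j k l)]
  exact hf l _ (cellMode_mem _ _ _)

theorem isOrthogonalDecomposition_centralMode : IsOrthogonalDecomposition centralMode ⊤ :=
  ⟨isClosed_centralMode, orthogonalFamily_centralMode, top_eq_closure_centralMode⟩

theorem isInvariant_centralMode (l : ℤ) : IsInvariant regRep (centralMode l) := by
  intro g f hf
  obtain ⟨F, hfF, hF⟩ := mem_centralMode_iff.1 hf
  refine mem_centralMode_iff.2 ⟨fun m => F (rmul g m), (coeFn_regRep g f).trans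
    ((mp_rmul g).quasiMeasurePreserving.ae_eq_comp hfF), fun a b c => ?_⟩
  have h (c : ℝ) : (⟨a, b, c⟩ * g : Heis) = ⟨a + g.a, b + g.b, c + (g.c + a * g.b)⟩ := by
    ext <;> simp; ring
  simp only [rmul_mk, h]
  rw [hF _ _ (c + _), hF _ _ (0 + _), zero_add, expo_add]
  ring

theorem hasSum_centralProj (f : L2M) : HasSum (fun l => centralProj l f) f := by
  have (l : ℤ) : CompleteSpace (centralMode l) := (isClosed_centralMode l).completeSpace_coe
  have hS : IsHilbertSum ℂ (fun l => centralMode l) (fun l => (centralMode l).subtypeₗᵢ) :=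
    IsHilbertSum.mkInternal _ orthogonalFamily_centralMode top_eq_closure_centralMode.le
  have hs := hS.hasSum_linearIsometryEquiv_symm (hS.linearIsometryEquiv f)
  rw [LinearIsometryEquiv.symm_apply_apply] at hs
  set w := hS.linearIsometryEquiv f
  -- Applying the continuous projection to the abstract Hilbert sum kills every term but one, which
  -- identifies the abstract components with the explicit integrals.
  have hw (l : ℤ) : centralProj l f = (w l : L2M) := by
    have h1 := (centralProj l).hasSum hs
    have h2 : (fun l' => centralProj l ((centralMode l').subtypeₗᵢ (w l'))) =
        fun l' => if l' = l then (w l : L2M) else 0 := by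
      funext l'
      refine (centralProj_of_mem (w l').2).trans ?_
      split_ifs with h
      · subst h; rfl
      · rfl
    rw [h2] at h1
    exact h1.unique (hasSum_ite_eq l (w l : L2M))
  have hw' : (fun l => centralProj l f) = fun l => (centralMode l).subtypeₗᵢ (w l) := funext hw
  rw [hw']
  exact hs

theorem ae_central_formula (l : ℤ) (f : L2M) : ∀ᵐ p : ℝ × ℝ × ℝ,
    IntervalIntegrable (fun t : ℝ => (f : M → ℂ) (mk ⟨p.1, p.2.1, t⟩)) volume 0 1 ∧
    (centralProj l f : M → ℂ) (mk ⟨p.1, p.2.1, p.2.2⟩) =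
      Complex.exp (2 * Real.pi * Complex.I * l * p.2.2) *
        ∫ t in (0 : ℝ)..1, (f : M → ℂ) (mk ⟨p.1, p.2.1, t⟩) *
          Complex.exp (-(2 * Real.pi * Complex.I * l * t)) := by
  filter_upwards [ae_toM (ae_integrable_centralAct f), ae_toM (coeFn_centralProj l f)]
    with ⟨a, b, c⟩ h1 h2
  refine ⟨?_, ?_⟩
  · simp only [toM, Heis.ofProd, centralAct_mk] at h1
    have h1' := (intervalIntegrable_iff_integrableOn_Ico_of_le zero_le_one).2 h1
    have h3 := h1'.comp_add_left (-c)
    simp only [add_neg_cancel_left, sub_neg_eq_add, zero_add] at h3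
    -- Integrability along the orbit starting at `c` concerns `[c, c + 1]`; periodicity moves it to
    -- `[0, 1]`.
    refine (periodic_central (f : M → ℂ) a b).intervalIntegrable one_ne_zero (t := c) ?_ 0 1
    rwa [add_comm c 1]
  · refine h2.trans ?_
    refine (centralCoeff_mk l f a b c).trans ?_
    simp [expo]

/-! ### The characters and the zero mode -/

theorem chiLift_eq (w : ℤ × ℤ) (x : Heis) : chiLift w x = expo w.1 x.a * expo w.2 x.b := by
  rw [chiLift, expo, expo, ← Complex.exp_add]
  ring_nf

theorem norm_chiLift (w : ℤ × ℤ) (x : Heis) : ‖chiLift w x‖ = 1 := by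
  rw [chiLift_eq, norm_mul, norm_expo, norm_expo, one_mul]

theorem isPeriodic_chiLift (w : ℤ × ℤ) : IsPeriodic (chiLift w) := by
  rintro _ ⟨m, n, p, rfl⟩ x
  simp only [chiLift_eq, Heis.mul_a, Heis.mul_b, add_comm _ x.a, add_comm _ x.b, expo_add_int]

theorem chi_mk (w : ℤ × ℤ) (x : Heis) : chi w (mk x) = chiLift w x :=
  onM_mk (isPeriodic_chiLift w) x

theorem norm_chi (w : ℤ × ℤ) (m : M) : ‖chi w m‖ = 1 := by
  obtain ⟨x, rfl⟩ := mk_surjective m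
  rw [chi_mk, norm_chiLift]

theorem contDiff_expo (n : ℤ) : ContDiff ℝ ∞ (expo n) := by
  unfold expo
  exact (contDiff_const.mul Complex.ofRealCLM.contDiff).cexp

theorem smoothOnM_chi (w : ℤ × ℤ) : SmoothOnM (chi w) := by
  simp only [SmoothOnM, chi_mk, chiLift_eq, Heis.ofProd]
  exact ((contDiff_expo _).comp contDiff_fst).mul
    ((contDiff_expo _).comp (contDiff_fst.comp contDiff_snd))

theorem chi_rmul (w : ℤ × ℤ) (g : Heis) (m : M) :
    chi w (rmul g m) = chiLift w g * chi w m := by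
  obtain ⟨x, rfl⟩ := mk_surjective m
  simp only [rmul_mk, chi_mk, chiLift_eq, Heis.mul_a, Heis.mul_b, expo_add]
  ring

/-- For `l = 0` the cell modes with exponential profile are the characters themselves, so
orthonormality and completeness are already available. -/
theorem chi_eq_cellMode (w : ℤ × ℤ) : chi w = cellMode w.2 0 (expo w.1) := by
  funext m
  conv_lhs => rw [← mk_rep m, chi_mk, chiLift_eq]
  simp [cellMode]

theorem measurable_chi (w : ℤ × ℤ) : Measurable (chi w) := by
  rw [chi_eq_cellMode]
  exact measurable_cellMode _ _ (continuous_expo _).measurable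

/-- The character `χ_w` as an element of `L²(M)`. -/
def chiLp (w : ℤ × ℤ) : L2M := (memLp_cellMode_expo w.1 w.2 0).toLp

theorem coeFn_chiLp (w : ℤ × ℤ) : (chiLp w : M → ℂ) =ᵐ[muM] chi w := by
  rw [chi_eq_cellMode]
  exact MemLp.coeFn_toLp _

theorem chiLp_mem (w : ℤ × ℤ) : chiLp w ∈ centralMode 0 := cellMode_mem _ _ _

theorem regRep_chiLp (g : Heis) (w : ℤ × ℤ) : regRep g (chiLp w) = chiLift w g • chiLp w := by
  refine Lp.ext ((coeFn_regRep g _).trans ?_)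
  filter_upwards [(mp_rmul g).quasiMeasurePreserving.ae_eq_comp (coeFn_chiLp w), coeFn_chiLp w,
    Lp.coeFn_smul (chiLift w g) (chiLp w)] with m h1 h2 h3
  simp only [Function.comp_apply] at h1
  rw [h1, h3, Pi.smul_apply, h2, chi_rmul, smul_eq_mul]

theorem inner_chiLp (w w' : ℤ × ℤ) : inner ℂ (chiLp w) (chiLp w') = if w = w' then 1 else 0 := by
  rw [chiLp, chiLp, inner_cellMode_cellMode]
  simp only [conj_expo, expo_mul_expo, integral_expo, neg_add_eq_zero, Prod.ext_iff]
  split_ifs <;> simp_all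

theorem chiLp_ne_zero (w : ℤ × ℤ) : chiLp w ≠ 0 := fun h => by
  have := inner_chiLp w w
  simp [h] at this

theorem isOrthogonalDecomposition_chiLp :
    IsOrthogonalDecomposition (fun w => Submodule.span ℂ {chiLp w}) (centralMode 0) := by
  refine ⟨fun w => Submodule.closed_of_finiteDimensional _, ?_, ?_⟩
  · rintro w w' h ⟨f, hf⟩ ⟨g, hg⟩
    obtain ⟨y, rfl⟩ := Submodule.mem_span_singleton.1 hf
    obtain ⟨z, rfl⟩ := Submodule.mem_span_singleton.1 hg
    change inner ℂ (y • chiLp w) (z • chiLp w') = 0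
    rw [inner_smul_left, inner_smul_right, inner_chiLp, if_neg h, mul_zero, mul_zero]
  · refine eq_closure_iSup_of_orthogonal _ _ (isClosed_centralMode 0)
      (fun w => (Submodule.span_singleton_le_iff_mem _ _).2 (chiLp_mem w)) fun f hf h => ?_
    exact eq_zero_of_mem_centralMode hf fun j k =>
      h (j, k) (chiLp (j, k)) (Submodule.mem_span_singleton_self _)

theorem isIrreducibleOn_chiLp (w : ℤ × ℤ) :
    IsIrreducibleOn regRep (Submodule.span ℂ {chiLp w}) := by
  refine ⟨fun g f hf => ?_, ?_, fun W hW _ _ => ?_⟩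
  · obtain ⟨z, rfl⟩ := Submodule.mem_span_singleton.1 hf
    rw [map_smul, regRep_chiLp]
    exact Submodule.smul_mem _ _ (Submodule.smul_mem _ _ (Submodule.mem_span_singleton_self _))
  · simpa using chiLp_ne_zero w
  · exact (nonzero_span_atom _ (chiLp_ne_zero w)).le_iff.1 hW

/-! ### Irreducibility of the Schrödinger representation -/

section Fourier

open scoped FourierTransform

/-- The Fourier transform is injective on `L¹(ℝ)`. -/
theorem ae_eq_zero_of_fourier_eq_zero {F : ℝ → ℂ} (hF : Integrable F)
    (h : ∀ w, 𝓕 F w = 0) : F =ᵐ[volume] 0 := by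
  refine ae_eq_zero_of_integral_contDiff_smul_eq_zero hF.locallyIntegrable fun g hg hgc => ?_
  have hgc' : HasCompactSupport fun x => (g x : ℂ) := hgc.comp_left Complex.ofReal_zero
  have hg' : ContDiff ℝ ∞ fun x => (g x : ℂ) := Complex.ofRealCLM.contDiff.comp hg
  set G : 𝓢(ℝ, ℂ) := hgc'.toSchwartzMap hg'
  have hG : 𝓕 (𝓕⁻ G) = G := FourierTransform.fourier_fourierInv_eq G
  -- The multiplication formula moves the Fourier transform onto `F`; every test function `G` is
  -- itself a Fourier transform.
  have h1 : ∫ x, 𝓕 (𝓕⁻ G : 𝓢(ℝ, ℂ)) x • F x = ∫ x, (𝓕⁻ G : 𝓢(ℝ, ℂ)) x • 𝓕 F x := by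
    have h2 := VectorFourier.integral_fourierIntegral_smul_eq_flip (L := innerₗ ℝ)
      (μ := volume) (ν := volume) Real.continuous_fourierChar continuous_inner
      (𝓕⁻ G : 𝓢(ℝ, ℂ)).integrable hF
    rw [flip_innerₗ] at h2
    rw [SchwartzMap.fourier_coe]
    exact h2
  rw [hG] at h1
  simp only [h, smul_zero, integral_zero] at h1
  rw [← h1]
  refine integral_congr_ae (.of_forall fun x => ?_)
  simp [G]

end Fourier

theorem inner_schrodinger (l : ℝ) (x : Heis) (f g : L2R) :
    inner ℂ (schrodinger l x f) g =
      ∫ u, starRingEnd ℂ (phase l x u) * (starRingEnd ℂ ((f : ℝ → ℂ) (u + x.a)) * (g : ℝ → ℂ) u) := by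
  rw [L2.inner_def]
  refine integral_congr_ae ((coeFn_schrodinger l x f).mono fun u hu => ?_)
  simp only [RCLike.inner_apply, hu, map_mul]
  ring

theorem integrable_conj_mul (f g : L2R) (a : ℝ) :
    Integrable fun u => starRingEnd ℂ ((f : ℝ → ℂ) (u + a)) * (g : ℝ → ℂ) u := by
  have h := (Lp.memLp f).comp_measurePreserving (measurePreserving_add_right volume a)
  exact MemLp.integrable_mul h.star (Lp.memLp g)

/-- For fixed `a`, the matrix coefficient at `(a, w / l, 0)` is, as a function of `w`, the Fourier
transform of this product. Here `l ≠ 0` makes every frequency reachable. -/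
theorem conj_mul_ae_eq_zero {l : ℝ} (hl : l ≠ 0) {f g : L2R}
    (h : ∀ x, inner ℂ (schrodinger l x f) g = 0) (a : ℝ) :
    (fun u => starRingEnd ℂ ((f : ℝ → ℂ) (u + a)) * (g : ℝ → ℂ) u) =ᵐ[volume] 0 := by
  refine ae_eq_zero_of_fourier_eq_zero (integrable_conj_mul f g a) fun w => ?_
  rw [← h ⟨a, w / l, 0⟩, inner_schrodinger, Real.fourier_eq]
  refine integral_congr_ae (.of_forall fun u => ?_)
  simp only [Circle.smul_def, smul_eq_mul]
  congr 1
  rw [Real.fourierChar_apply, phase, ← Complex.exp_conj]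
  congr 1
  have hl' : (l : ℂ) ≠ 0 := Complex.ofReal_ne_zero.2 hl
  simp [Complex.conj_ofNat]
  field_simp

/-- By Tonelli and translation invariance, the integral of the absolute value over `u` and `a` is
the product of the integrals of `|f|` and `|g|`, taken in `[0, ∞]`, so neither function need be
integrable. -/
theorem eq_zero_or_eq_zero_of_forall_translate {f g : L2R}
    (h : ∀ a : ℝ, (fun u => starRingEnd ℂ ((f : ℝ → ℂ) (u + a)) * (g : ℝ → ℂ) u) =ᵐ[volume] 0) :
    f = 0 ∨ g = 0 := by
  have hf : Measurable fun u => ‖(f : ℝ → ℂ) u‖ₑ := (Lp.stronglyMeasurable f).measurable.enorm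
  have hg : Measurable fun u => ‖(g : ℝ → ℂ) u‖ₑ := (Lp.stronglyMeasurable g).measurable.enorm
  have h1 : ∫⁻ a : ℝ, ∫⁻ u : ℝ, ‖(f : ℝ → ℂ) (u + a)‖ₑ * ‖(g : ℝ → ℂ) u‖ₑ = 0 := by
    refine (lintegral_congr fun a => ?_).trans lintegral_zero
    refine (lintegral_congr_ae ((h a).mono fun u hu => ?_)).trans lintegral_zero
    have := congrArg (fun z : ℂ => ‖z‖ₑ) hu
    simpa [enorm_mul] using this
  rw [lintegral_lintegral_swap (((hf.comp (measurable_snd.add measurable_fst)).mul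
    (hg.comp measurable_snd)).aemeasurable)] at h1
  have h2 (u : ℝ) : ∫⁻ a : ℝ, ‖(f : ℝ → ℂ) (u + a)‖ₑ * ‖(g : ℝ → ℂ) u‖ₑ =
      (∫⁻ a : ℝ, ‖(f : ℝ → ℂ) a‖ₑ) * ‖(g : ℝ → ℂ) u‖ₑ := by
    rw [lintegral_mul_const (f := fun a => ‖(f : ℝ → ℂ) (u + a)‖ₑ) _
      (hf.comp (measurable_const_add u)),
      lintegral_add_left_eq_self (fun a => ‖(f : ℝ → ℂ) a‖ₑ) u]
  simp only [h2] at h1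
  rw [lintegral_const_mul _ hg, mul_eq_zero] at h1
  have h3 (f : L2R) (h : ∫⁻ a : ℝ, ‖(f : ℝ → ℂ) a‖ₑ = 0) : f = 0 := by
    rw [lintegral_eq_zero_iff (Lp.stronglyMeasurable f).measurable.enorm] at h
    refine Lp.ext (.trans ?_ (Lp.coeFn_zero _ _ _).symm)
    filter_upwards [h] with u hu
    simpa using hu
  exact h1.imp (h3 f) (h3 g)

instance : Nontrivial L2R := by
  refine ⟨indicatorConstLp 2 (measurableSet_Icc (a := (0 : ℝ)) (b := 1)) (by simp) 1, 0, fun h => ?_⟩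
  have := congrArg norm h
  rw [norm_indicatorConstLp (by norm_num) (by norm_num)] at this
  simp at this

/-- The Schrödinger representation with non-zero parameter is irreducible. -/
theorem isIrreducibleOn_schrodinger {l : ℝ} (hl : l ≠ 0) : IsIrreducibleOn (schrodinger l) ⊤ := by
  refine ⟨fun _ _ _ => trivial, top_ne_bot, fun W _ hW hinv => ?_⟩
  refine or_iff_not_imp_left.2 fun hne => ?_
  obtain ⟨f, hfW, hf⟩ := W.ne_bot_iff.1 hne
  have : CompleteSpace W := hW.completeSpace_coe
  rw [← Submodule.orthogonal_eq_bot_iff, Submodule.eq_bot_iff]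
  intro g hg
  exact (eq_zero_or_eq_zero_of_forall_translate (conj_mul_ae_eq_zero hl fun x =>
    (Submodule.mem_orthogonal W g).1 hg _ (hinv x f hfW))).resolve_left hf

/-! ### The Berezin–Weil–Zak transform of Schwartz functions -/

theorem summable_inv_one_add_abs_sq : Summable fun k : ℤ => ((1 + |(k : ℝ)|) ^ 2)⁻¹ := by
  have h1 : Summable fun k : ℤ => 1 / (k : ℝ) ^ 2 := Real.summable_one_div_int_pow.2 one_lt_two
  -- This term covers `k = 0`, where `1 / k ^ 2` takes the value `0`.
  have h2 : Summable fun k : ℤ => if k = 0 then (1 : ℝ) else 0 := (hasSum_ite_eq 0 1).summable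
  refine (h1.add h2).of_nonneg_of_le (fun k => by positivity) fun k => ?_
  split_ifs with h
  · simp [h]
  · have hk : 0 < |(k : ℝ)| := abs_pos.2 (Int.cast_ne_zero.2 h)
    rw [add_zero, one_div, ← sq_abs (k : ℝ)]
    gcongr
    linarith

/-- The samples `k ^ n h (k / l + a)` of a Schwartz function decay quadratically in `k`,
uniformly for bounded `a`. -/
theorem exists_sample_bound {l : ℤ} (hl : l ≠ 0) (h : 𝓢(ℝ, ℂ)) (n : ℕ) (R : ℝ) :
    ∃ C : ℝ, ∀ (k : ℤ) (a : ℝ), |a| ≤ R →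
      |(k : ℝ)| ^ n * ‖h ((k : ℝ) / l + a)‖ ≤ C * ((1 + |(k : ℝ)|) ^ 2)⁻¹ := by
  set D := 2 ^ (n + 2) * ((Finset.Iic (n + 2, 0)).sup fun m => SchwartzMap.seminorm ℂ m.1 m.2) h
  -- Of the `n + 2` powers of decay, `n` absorb the weight and `2` leave a summable bound. The base
  -- comes from `k = l * (u - a)`, which compares `1 + |k|` with `1 + |u|`.
  refine ⟨(|(l : ℝ)| * (1 + R)) ^ (n + 2) * D, fun k a ha => ?_⟩
  set u := (k : ℝ) / l + a
  have hR : 0 ≤ R := (abs_nonneg a).trans ha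
  have hl1 : 1 ≤ |(l : ℝ)| := by exact_mod_cast Int.one_le_abs hl
  have hl0 : (l : ℝ) ≠ 0 := Int.cast_ne_zero.2 hl
  have hD : (1 + |u|) ^ (n + 2) * ‖h u‖ ≤ D := by
    simpa using SchwartzMap.one_add_le_sup_seminorm_apply (𝕜 := ℂ) (m := (n + 2, 0)) le_rfl le_rfl
      h u
  have hk : 1 + |(k : ℝ)| ≤ |(l : ℝ)| * (1 + R) * (1 + |u|) := by
    have h1 : (k : ℝ) = l * (u - a) := by simp only [u]; field_simp; ring
    have h2 : |(k : ℝ)| ≤ |(l : ℝ)| * (|u| + R) := by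
      rw [h1, abs_mul]
      gcongr
      exact (abs_sub u a).trans (by linarith)
    have : 0 ≤ |(l : ℝ)| * (R * |u|) := by positivity
    nlinarith [abs_nonneg u]
  rw [← div_eq_mul_inv, le_div_iff₀ (by positivity)]
  calc |(k : ℝ)| ^ n * ‖h u‖ * (1 + |(k : ℝ)|) ^ 2
      ≤ (1 + |(k : ℝ)|) ^ n * ‖h u‖ * (1 + |(k : ℝ)|) ^ 2 := by
        gcongr; linarith
    _ = (1 + |(k : ℝ)|) ^ (n + 2) * ‖h u‖ := by ring
    _ ≤ (|(l : ℝ)| * (1 + R) * (1 + |u|)) ^ (n + 2) * ‖h u‖ := by gcongr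
    _ = (|(l : ℝ)| * (1 + R)) ^ (n + 2) * ((1 + |u|) ^ (n + 2) * ‖h u‖) := by
        rw [mul_pow _ (1 + |u|), mul_assoc]
    _ ≤ _ := by gcongr

/-! ### Smoothness of the Zak series. -/

/-- The terms of the Zak series, with polynomial weights. -/
def zakTerm (l q : ℤ) (h : 𝓢(ℝ, ℂ)) (n : ℕ) (p : ℝ × ℝ) (k : ℤ) : ℂ :=
  (k : ℂ) ^ n * (expo (-q) ((k : ℝ) / l) * (expo k p.2 * h ((k : ℝ) / l + p.1)))

theorem norm_zakTerm (l q : ℤ) (h : 𝓢(ℝ, ℂ)) (n : ℕ) (p : ℝ × ℝ) (k : ℤ) :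
    ‖zakTerm l q h n p k‖ = |(k : ℝ)| ^ n * ‖h ((k : ℝ) / l + p.1)‖ := by
  simp [zakTerm, norm_expo]

theorem exists_zakTerm_bound {l : ℤ} (hl : l ≠ 0) (q : ℤ) (h : 𝓢(ℝ, ℂ)) (n : ℕ) (R : ℝ) :
    ∃ u : ℤ → ℝ, Summable u ∧ ∀ k, ∀ p : ℝ × ℝ, |p.1| ≤ R → ‖zakTerm l q h n p k‖ ≤ u k := by
  obtain ⟨C, hC⟩ := exists_sample_bound hl h n R
  exact ⟨_, summable_inv_one_add_abs_sq.mul_left C, fun k p hp => by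
    rw [norm_zakTerm]; exact hC k p.1 hp⟩

theorem summable_zakTerm {l : ℤ} (hl : l ≠ 0) (q : ℤ) (h : 𝓢(ℝ, ℂ)) (n : ℕ) (p : ℝ × ℝ) :
    Summable (zakTerm l q h n p) := by
  obtain ⟨u, hu, hb⟩ := exists_zakTerm_bound hl q h n |p.1|
  exact .of_norm_bounded hu fun k => hb k p le_rfl

/-- The sum of the Zak series. -/
def zakSum (l q : ℤ) (h : 𝓢(ℝ, ℂ)) (n : ℕ) (p : ℝ × ℝ) : ℂ := ∑' k, zakTerm l q h n p k

/-- The real derivative on `ℝ × ℝ` with the given partial derivatives. -/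
def partials (z w : ℂ) : ℝ × ℝ →L[ℝ] ℂ :=
  (ContinuousLinearMap.fst ℝ ℝ ℝ).smulRight z + (ContinuousLinearMap.snd ℝ ℝ ℝ).smulRight w

theorem norm_partials_le (z w : ℂ) : ‖partials z w‖ ≤ ‖z‖ + ‖w‖ := by
  refine (norm_add_le _ _).trans ?_
  rw [ContinuousLinearMap.norm_smulRight_apply, ContinuousLinearMap.norm_smulRight_apply]
  refine add_le_add ?_ ?_
  · exact mul_le_of_le_one_left (norm_nonneg _) (ContinuousLinearMap.norm_fst_le ℝ ℝ ℝ)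
  · exact mul_le_of_le_one_left (norm_nonneg _) (ContinuousLinearMap.norm_snd_le ℝ ℝ ℝ)

theorem hasDerivAt_expo (n : ℤ) (t : ℝ) :
    HasDerivAt (expo n) (2 * Real.pi * Complex.I * n * expo n t) t := by
  have h := ((Complex.ofRealCLM.hasDerivAt (x := t)).const_mul
    (2 * Real.pi * Complex.I * n : ℂ)).cexp
  refine h.congr_deriv ?_
  simp [expo]
  ring

/-- Differentiating in the first variable replaces `h` by its derivative, in the second raises the
weight `n` by one: the family of Zak terms is closed under differentiation. -/
theorem hasFDerivAt_zakTerm (l q : ℤ) (h : 𝓢(ℝ, ℂ)) (n : ℕ) (p : ℝ × ℝ) (k : ℤ) :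
    HasFDerivAt (fun p => zakTerm l q h n p k)
      (partials (zakTerm l q (SchwartzMap.derivCLM ℂ ℂ h) n p k)
        (2 * Real.pi * Complex.I * zakTerm l q h (n + 1) p k)) p := by
  have h1 : HasFDerivAt (fun p : ℝ × ℝ => expo k p.2) _ p :=
    (hasDerivAt_expo k p.2).hasFDerivAt.comp p hasFDerivAt_snd
  have h2 : HasDerivAt (fun a : ℝ => h ((k : ℝ) / l + a)) (deriv h ((k : ℝ) / l + p.1)) p.1 :=
    (h.differentiableAt (x := (k : ℝ) / l + p.1)).hasDerivAt.comp_const_add _ _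
  have h3 : HasFDerivAt (fun p : ℝ × ℝ => h ((k : ℝ) / l + p.1)) _ p :=
    h2.hasFDerivAt.comp p hasFDerivAt_fst
  refine (((h1.mul h3).const_mul (expo (-q) ((k : ℝ) / l))).const_mul ((k : ℂ) ^ n)).congr_fderiv ?_
  ext <;> simp [partials, zakTerm]
  ring

theorem hasFDerivAt_zakSum {l : ℤ} (hl : l ≠ 0) (q : ℤ) (h : 𝓢(ℝ, ℂ)) (n : ℕ) (p : ℝ × ℝ) :
    HasFDerivAt (zakSum l q h n) (partials (zakSum l q (SchwartzMap.derivCLM ℂ ℂ h) n p)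
      (2 * Real.pi * Complex.I * zakSum l q h (n + 1) p)) p := by
  have hs1 := summable_zakTerm hl q (SchwartzMap.derivCLM ℂ ℂ h) n p
  have hs2 := (summable_zakTerm hl q h (n + 1) p).mul_left (2 * Real.pi * Complex.I)
  obtain ⟨u, hu, hub⟩ := exists_zakTerm_bound hl q (SchwartzMap.derivCLM ℂ ℂ h) n (‖p‖ + 1)
  obtain ⟨v, hv, hvb⟩ := exists_zakTerm_bound hl q h (n + 1) (‖p‖ + 1)
  have hp : p ∈ Metric.ball (0 : ℝ × ℝ) (‖p‖ + 1) := by simp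
  -- Domination of the derivatives is uniform only for bounded first coordinate, so the series is
  -- differentiated on a ball containing `p`.
  have key := hasFDerivAt_tsum_of_isPreconnected (hu.add (hv.mul_left (2 * Real.pi)))
    Metric.isOpen_ball (convex_ball (0 : ℝ × ℝ) (‖p‖ + 1)).isPreconnected
    (fun k x _ => hasFDerivAt_zakTerm l q h n x k) (fun k x hx => ?_) hp
    (summable_zakTerm hl q h n p) hp
  · refine key.congr_fderiv ?_
    have h1 := (ContinuousLinearMap.smulRightL ℝ (ℝ × ℝ) ℂ (ContinuousLinearMap.fst ℝ ℝ ℝ)).hasSum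
      hs1.hasSum
    have h2 := (ContinuousLinearMap.smulRightL ℝ (ℝ × ℝ) ℂ (ContinuousLinearMap.snd ℝ ℝ ℝ)).hasSum
      hs2.hasSum
    refine (h1.add h2).tsum_eq.trans ?_
    rw [tsum_mul_left]
    rfl
  · have hx1 : |x.1| ≤ ‖p‖ + 1 :=
      (norm_fst_le x).trans (mem_ball_zero_iff.1 hx).le
    refine (norm_partials_le _ _).trans (add_le_add (hub k x hx1) ?_)
    have h2π : ‖(2 * Real.pi * Complex.I : ℂ)‖ = 2 * Real.pi := by
      simp [abs_of_pos Real.pi_pos]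
    rw [norm_mul, h2π]
    exact mul_le_mul_of_nonneg_left (hvb k x hx1) Real.two_pi_pos.le

theorem contDiff_zakSum {l : ℤ} (hl : l ≠ 0) (q : ℤ) (h : 𝓢(ℝ, ℂ)) (n : ℕ) :
    ContDiff ℝ ∞ (zakSum l q h n) := by
  refine contDiff_infty.2 fun m => ?_
  -- The derivative involves the sums for `h'` and for weight `n + 1`, so both parameters must vary.
  induction m generalizing h n with
  | zero => exact contDiff_zero.2 (continuous_iff_continuousAt.2 fun p =>
      (hasFDerivAt_zakSum hl q h n p).continuousAt)
  | succ m ih =>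
    push_cast
    rw [contDiff_succ_iff_fderiv]
    refine ⟨fun p => (hasFDerivAt_zakSum hl q h n p).differentiableAt, by simp, ?_⟩
    have : fderiv ℝ (zakSum l q h n) = fun p => partials
        (zakSum l q (SchwartzMap.derivCLM ℂ ℂ h) n p)
        (2 * Real.pi * Complex.I * zakSum l q h (n + 1) p) :=
      funext fun p => (hasFDerivAt_zakSum hl q h n p).fderiv
    rw [this]
    exact (((ContinuousLinearMap.smulRightL ℝ (ℝ × ℝ) ℂ
      (ContinuousLinearMap.fst ℝ ℝ ℝ)).contDiff.comp (ih _ n)).add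
      ((ContinuousLinearMap.smulRightL ℝ (ℝ × ℝ) ℂ
      (ContinuousLinearMap.snd ℝ ℝ ℝ)).contDiff.comp (contDiff_const.mul (ih h (n + 1)))))

/-! ### Periodicity and translation identities by reindexing. -/

theorem bwzTerm_eq (l q : ℤ) (h : 𝓢(ℝ, ℂ)) (x : Heis) (k : ℤ) :
    bwzTerm l q h x k =
      expo (-q) ((k : ℝ) / l) * (expo l x.c * expo k x.b) * h ((k : ℝ) / l + x.a) := by
  simp only [bwzTerm, expo, ← Complex.exp_add]
  congr 3
  · push_cast; ring
  · ring

theorem bwzTerm_eq_zakTerm (l q : ℤ) (h : 𝓢(ℝ, ℂ)) (x : Heis) (k : ℤ) :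
    bwzTerm l q h x k = expo l x.c * zakTerm l q h 0 (x.a, x.b) k := by
  rw [bwzTerm_eq, zakTerm]
  ring

theorem summable_bwzTerm {l : ℤ} (hl : l ≠ 0) (q : ℤ) (h : 𝓢(ℝ, ℂ)) (x : Heis) :
    Summable (bwzTerm l q h x) := by
  simp only [funext (bwzTerm_eq_zakTerm l q h x)]
  exact (summable_zakTerm hl q h 0 _).mul_left _

/-- The normalizing constant of the transform. -/
def bwzConst (l : ℤ) : ℂ := ((Real.sqrt |(l : ℝ)| / l : ℝ) : ℂ)

theorem bwzLift_eq_zakSum (l q : ℤ) (h : 𝓢(ℝ, ℂ)) (x : Heis) :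
    bwzLift l q h x = bwzConst l * (expo l x.c * zakSum l q h 0 (x.a, x.b)) := by
  simp only [bwzLift, bwzTerm_eq_zakTerm, tsum_mul_left, bwzConst, zakSum]

theorem bwzLift_eq_tsum (l q : ℤ) (h : 𝓢(ℝ, ℂ)) (x : Heis) :
    bwzLift l q h x = bwzConst l * ∑' k, bwzTerm l q h x k := rfl

/-- A relation between shifted terms gives a relation between the transforms. -/
theorem bwzLift_eq_of_shift {l q q' : ℤ} {h h' : 𝓢(ℝ, ℂ)} {x y : Heis} (z : ℂ) (m : ℤ)
    (H : ∀ k, bwzTerm l q h x k = z * bwzTerm l q' h' y (k + m)) :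
    bwzLift l q h x = z * bwzLift l q' h' y := by
  rw [bwzLift_eq_tsum, bwzLift_eq_tsum, ← (Equiv.addRight m).tsum_eq (bwzTerm l q' h' y)]
  simp only [H, tsum_mul_left, Equiv.coe_addRight]
  ring

theorem expo_div_comm (n m : ℤ) (t : ℝ) : expo n ((m : ℝ) / t) = expo m ((n : ℝ) / t) := by
  unfold expo; push_cast; ring_nf

theorem expo_eq_mul_of {n m p : ℤ} (t : ℝ) (h : n = m + p) : expo n t = expo m t * expo p t := by
  rw [h, expo_mul_expo]

/-- Adding an integer `m` to `a` moves the sample point from index `k` to `k + l * m`. The resulting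
change of phase in `b` is exactly the term `m * b` that the group law adds to `c`. -/
theorem isPeriodic_bwzLift {l : ℤ} (hl : l ≠ 0) (q : ℤ) (h : 𝓢(ℝ, ℂ)) :
    IsPeriodic (bwzLift l q h) := by
  rintro _ ⟨m, n, p, rfl⟩ ⟨a, b, c⟩
  have hl0 : (l : ℝ) ≠ 0 := Int.cast_ne_zero.2 hl
  rw [← one_mul (bwzLift l q h ⟨a, b, c⟩)]
  refine bwzLift_eq_of_shift 1 (l * m) fun k => ?_
  have h1 : ((k + l * m : ℤ) : ℝ) / l = k / l + m := by push_cast; field_simp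
  have h2 : expo l ((p : ℝ) + c + m * b) = expo l c * expo (l * m) b := by
    rw [add_comm (p : ℝ), add_right_comm, expo_add_int, expo_add]
    congr 1
    unfold expo; push_cast; ring_nf
  simp only [bwzTerm_eq, Heis.mul_a, Heis.mul_b, Heis.mul_c, h1, h2, expo_add_int]
  rw [expo_eq_mul_of b rfl, add_comm (n : ℝ), expo_add_int, add_assoc]
  ring

theorem bwz_mk {l : ℤ} (hl : l ≠ 0) (q : ℤ) (h : 𝓢(ℝ, ℂ)) (x : Heis) :
    bwz l q h (mk x) = bwzLift l q h x := onM_mk (isPeriodic_bwzLift hl q h) x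

theorem smoothOnM_bwz {l : ℤ} (hl : l ≠ 0) (q : ℤ) (h : 𝓢(ℝ, ℂ)) : SmoothOnM (bwz l q h) := by
  simp only [SmoothOnM, bwz_mk hl, bwzLift_eq_zakSum, Heis.ofProd]
  exact contDiff_const.mul (((contDiff_expo l).comp (contDiff_snd.comp contDiff_snd)).mul
    ((contDiff_zakSum hl q h 0).comp (contDiff_fst.prodMk (contDiff_fst.comp contDiff_snd))))

theorem expo_mul_div {l : ℤ} (hl : l ≠ 0) (m k : ℤ) : expo (l * m) ((k : ℝ) / l) = 1 := by
  have hl0 : (l : ℂ) ≠ 0 := Int.cast_ne_zero.2 hl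
  rw [← expo_int m k, expo, expo]
  congr 1
  push_cast
  field_simp

theorem bwz_periodic {l : ℤ} (hl : l ≠ 0) (q m : ℤ) (h : 𝓢(ℝ, ℂ)) :
    bwz l (l * m + q) h = bwz l q h := by
  funext y
  obtain ⟨x, rfl⟩ := mk_surjective y
  rw [bwz_mk hl, bwz_mk hl, ← one_mul (bwzLift l q h x)]
  refine bwzLift_eq_of_shift 1 0 fun k => ?_
  rw [add_zero, one_mul, bwzTerm_eq, bwzTerm_eq,
    expo_eq_mul_of (n := -(l * m + q)) (m := l * (-m)) (p := -q) _ (by ring), expo_mul_div hl,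
    one_mul]

/-- Moving `a` by `q / l` shifts the summation index by `q`. -/
theorem bwz_rmul_a {l : ℤ} (hl : l ≠ 0) (q₀ q : ℤ) (h : 𝓢(ℝ, ℂ)) (a b c : ℝ) :
    bwz l q₀ h (rmul ⟨q / l, 0, 0⟩ (mk ⟨a, b, c⟩)) =
      expo (-q) b * expo q₀ ((q : ℝ) / l) * bwz l q₀ h (mk ⟨a, b, c⟩) := by
  rw [rmul_mk, bwz_mk hl, bwz_mk hl]
  refine bwzLift_eq_of_shift _ q fun k => ?_
  have h1 : ((k + q : ℤ) : ℝ) / l = k / l + q / l := by push_cast; ring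
  have h2 : (k : ℝ) / l + (a + q / l) = k / l + q / l + a := by ring
  have h3 := expo_mul_expo q₀ (-q₀) ((q : ℝ) / l)
  have h4 := expo_mul_expo q (-q) b
  rw [add_neg_cancel, expo_zero] at h3 h4
  simp only [bwzTerm_eq, Heis.mul_a, Heis.mul_b, Heis.mul_c, h1, h2, mul_zero, add_zero, expo_add]
  rw [expo_eq_mul_of b (rfl : k + q = k + q)]
  linear_combination (-(expo (-q₀) ((k : ℝ) / l) * (expo l c * expo k b) *
    h (k / l + q / l + a))) * (expo q b * expo (-q) b * h3 + h4)

/-- No reindexing occurs: the extra phase `e^{2πikq/l}` in the `k`-th term turns `q₀` into `q₀ - q`.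
-/
theorem bwz_rmul_b {l : ℤ} (hl : l ≠ 0) (q₀ q : ℤ) (h : 𝓢(ℝ, ℂ)) (a b c : ℝ) :
    bwz l q₀ h (rmul ⟨0, q / l, 0⟩ (mk ⟨a, b, c⟩)) =
      expo q a * bwz l (q₀ - q) h (mk ⟨a, b, c⟩) := by
  have hl0 : (l : ℂ) ≠ 0 := Int.cast_ne_zero.2 hl
  rw [rmul_mk, bwz_mk hl, bwz_mk hl]
  refine bwzLift_eq_of_shift _ 0 fun k => ?_
  have h1 : expo l (a * (q / l)) = expo q a := by
    unfold expo; push_cast; congr 1; field_simp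
  simp only [bwzTerm_eq, Heis.mul_a, Heis.mul_b, Heis.mul_c, add_zero, expo_add, h1]
  rw [expo_div_comm k q, expo_eq_mul_of (n := -(q₀ - q)) (m := -q₀) (p := q) _ (by ring)]
  ring

/-! ### The Schrödinger action on Schwartz functions. -/

theorem hasTemperateGrowth_cexp (β : ℝ) :
    (fun u : ℝ => Complex.exp ((β * Complex.I) * u)).HasTemperateGrowth := by
  have hd (u : ℝ) : HasDerivAt (fun u : ℝ => Complex.exp ((β * Complex.I) * u))
      (β * Complex.I * Complex.exp ((β * Complex.I) * u)) u := by
    refine ((Complex.ofRealCLM.hasDerivAt (x := u)).const_mul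
      (β * Complex.I : ℂ)).cexp.congr_deriv ?_
    simp
    ring
  have hi (n : ℕ) : iteratedDeriv n (fun u : ℝ => Complex.exp ((β * Complex.I) * u)) =
      fun u : ℝ => (β * Complex.I) ^ n * Complex.exp ((β * Complex.I) * u) := by
    induction n with
    | zero => simp
    | succ n ih =>
      rw [iteratedDeriv_succ, ih]
      funext u
      rw [((hd u).const_mul _).deriv]
      ring
  refine ⟨(contDiff_const.mul Complex.ofRealCLM.contDiff).cexp, fun n => ⟨0, |β| ^ n, fun u => ?_⟩⟩
  have h1 : ‖Complex.exp ((β * Complex.I) * u)‖ = 1 := by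
    rw [mul_right_comm, ← Complex.ofReal_mul, Complex.norm_exp_ofReal_mul_I]
  rw [norm_iteratedFDeriv_eq_norm_iteratedDeriv, hi]
  simp [h1]

/-- The Schrödinger representation preserves the Schwartz space. -/
theorem exists_schwartz_schrodinger (l : ℝ) (g : Heis) (h : 𝓢(ℝ, ℂ)) :
    ∃ h' : 𝓢(ℝ, ℂ), ∀ u, h' u = phase l g u * h (u + g.a) := by
  have hg : (fun u : ℝ => Complex.exp (2 * Real.pi * Complex.I * l * g.c) *
      Complex.exp (((2 * Real.pi * l * g.b : ℝ) * Complex.I) * u)).HasTemperateGrowth :=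
    (Function.HasTemperateGrowth.const _).mul (hasTemperateGrowth_cexp _)
  refine ⟨SchwartzMap.smulLeftCLM ℂ (fun u : ℝ => Complex.exp (2 * Real.pi * Complex.I * l * g.c) *
    Complex.exp (((2 * Real.pi * l * g.b : ℝ) * Complex.I) * u))
    (SchwartzMap.compSubConstCLM ℂ (-g.a) h), fun u => ?_⟩
  rw [SchwartzMap.smulLeftCLM_apply_apply hg, ← Complex.exp_add, phase,
    SchwartzMap.compSubConstCLM_apply, sub_neg_eq_add, smul_eq_mul]
  congr 2
  push_cast
  ring

/-- The series agree term by term: at `k / l + a` the Schrödinger phase is precisely the change of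
the central and `b` phases under right multiplication by `g`. -/
theorem bwz_schrodinger {l : ℤ} (hl : l ≠ 0) (q : ℤ) {g : Heis} {h h' : 𝓢(ℝ, ℂ)}
    (hh : ∀ u, h' u = phase l g u * h (u + g.a)) (m : M) :
    bwz l q h' m = bwz l q h (rmul g m) := by
  have hl0 : (l : ℂ) ≠ 0 := Int.cast_ne_zero.2 hl
  obtain ⟨⟨a, b, c⟩, rfl⟩ := mk_surjective m
  rw [rmul_mk, bwz_mk hl, bwz_mk hl, ← one_mul (bwzLift l q h _)]
  refine bwzLift_eq_of_shift 1 0 fun k => ?_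
  have h1 : phase l g ((k : ℝ) / l + a) = expo l (g.c + a * g.b) * expo k g.b := by
    rw [phase, expo, expo, ← Complex.exp_add]
    congr 1
    push_cast
    field_simp
    ring
  simp only [bwzTerm_eq, Heis.mul_a, Heis.mul_b, Heis.mul_c, add_zero, one_mul, hh, h1, add_assoc,
    expo_add]
  ring

/-! ### Series in `L²` -/

theorem coeFn_sum_toLp {ι : Type*} {v : ι → M → ℂ} (hv : ∀ k, MemLp (v k) 2 muM)
    (s : Finset ι) :
    ((∑ k ∈ s, (hv k).toLp : L2M) : M → ℂ) =ᵐ[muM] fun m => ∑ k ∈ s, v k m := by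
  classical
  induction s using Finset.induction_on with
  | empty =>
    simp only [Finset.sum_empty]
    exact Lp.coeFn_zero ℂ 2 muM
  | insert k s hk ih =>
    rw [Finset.sum_insert hk]
    filter_upwards [Lp.coeFn_add (hv k).toLp (∑ k ∈ s, (hv k).toLp), (hv k).coeFn_toLp, ih]
      with m h1 h2 h3
    rw [h1, Pi.add_apply, h2, h3, Finset.sum_insert hk]

theorem norm_le_of_ae_bound_muM {f : L2M} {C : ℝ} (hC : 0 ≤ C)
    (h : ∀ᵐ m ∂muM, ‖(f : M → ℂ) m‖ ≤ C) : ‖f‖ ≤ C := by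
  have := Lp.norm_le_of_ae_bound hC h
  simpa [measureUnivNNReal] using this

/-- A series of functions dominated by a summable sequence converges in `L²(M)`. -/
theorem hasSum_toLp {ι : Type*} {v : ι → M → ℂ} (hv : ∀ k, MemLp (v k) 2 muM) {u : ι → ℝ}
    (hu : Summable u) (hvu : ∀ k m, ‖v k m‖ ≤ u k) {F : M → ℂ} (hF : MemLp F 2 muM)
    (hFv : ∀ m, F m = ∑' k, v k m) : HasSum (fun k => (hv k).toLp) hF.toLp := by
  have hu0 (k : ι) : 0 ≤ u k := (norm_nonneg _).trans (hvu k (mk 1))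
  -- The tail bounds the remainder uniformly, hence in `L²`, as `M` has mass one.
  have htail := tendsto_tsum_compl_atTop_zero u
  rw [HasSum, tendsto_iff_norm_sub_tendsto_zero]
  refine squeeze_zero (fun _ => norm_nonneg _) (fun s => ?_) htail
  refine norm_le_of_ae_bound_muM (tsum_nonneg fun k => hu0 k) ?_
  filter_upwards [Lp.coeFn_sub (∑ k ∈ s, (hv k).toLp) hF.toLp, coeFn_sum_toLp hv s,
    hF.coeFn_toLp] with m h1 h2 h3
  have hsm : Summable fun k => v k m := .of_norm_bounded hu fun k => hvu k m
  rw [h1, Pi.sub_apply, h2, h3, hFv, ← hsm.sum_add_tsum_compl (s := s), sub_add_cancel_left,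
    norm_neg]
  have hsn : Summable fun k : {k // k ∉ s} => u k := hu.subtype _
  exact tsum_of_norm_bounded hsn.hasSum fun k => hvu k m

/-- Pythagoras for convergent series of pairwise orthogonal vectors. -/
theorem hasSum_norm_sq_of_orthogonal {E ι : Type*} [NormedAddCommGroup E] [InnerProductSpace ℂ E]
    {v : ι → E} {S : E} (hS : HasSum v S) (hv : ∀ i j, i ≠ j → inner ℂ (v i) (v j) = 0) :
    HasSum (fun i => ‖v i‖ ^ 2) (‖S‖ ^ 2) := by
  classical
  have h1 (i : ι) : inner ℂ S (v i) = inner ℂ (v i) (v i) := by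
    have h2 := ((innerSL ℂ (v i)).hasSum hS)
    have h3 : (fun j => innerSL ℂ (v i) (v j)) =
        fun j => if j = i then inner ℂ (v i) (v i) else 0 := by
      funext j
      split_ifs with h
      · subst h; rfl
      · exact hv i j (Ne.symm h)
    rw [h3] at h2
    have h5 : inner ℂ (v i) S = inner ℂ (v i) (v i) := h2.unique (hasSum_ite_eq i _)
    rw [← inner_conj_symm, h5, inner_conj_symm]
  have h2 := (innerSL ℂ S).hasSum hS
  have h3 := Complex.reCLM.hasSum h2
  have h4 (x : E) : (inner ℂ x x).re = ‖x‖ ^ 2 := inner_self_eq_norm_sq (𝕜 := ℂ) x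
  simpa only [innerSL_apply_apply, Complex.reCLM_apply, h1, h4] using h3

/-! ### Sampling on cosets of a lattice -/

theorem hasSum_translates {F : ℝ → ℝ} (hF : Integrable F) (y : ℝ) :
    HasSum (fun m : ℤ => ∫ a, F (y + m + a) ∂unitMeasure) (∫ x, F x) := by
  have h (m : ℤ) : ∫ a, F (y + m + a) ∂unitMeasure = ∫ x in y + m..y + m + 1, F x := by
    rw [unitMeasure, integral_Ico_eq_integral_Ioc,
      ← intervalIntegral.integral_of_le zero_le_one,
      intervalIntegral.integral_comp_add_left F (y + m), add_zero]
  simpa only [h] using hF.hasSum_intervalIntegral y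

/-- The sign is that of `l`: when `l` is negative the sample points run through the line backwards.
-/
theorem hasSum_translates_sign {F : ℝ → ℝ} (hF : Integrable F) (y : ℝ) {s : ℝ}
    (hs : s = 1 ∨ s = -1) :
    HasSum (fun m : ℤ => ∫ a, F (y + s * m + a) ∂unitMeasure) (∫ x, F x) := by
  rcases hs with rfl | rfl
  · simpa using hasSum_translates hF y
  · have := (Equiv.neg ℤ).hasSum_iff.2 (hasSum_translates hF y)
    simpa [Function.comp_def] using this

/-- Writing `k = m * |l| + r`, for each of the `|l|` residues `r` the intervals `k / l + [0,1)` tile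
the line once. The summability hypothesis permits the rearrangement; `norm_bwz_toLp` obtains it from
Pythagoras. -/
theorem tsum_samples {l : ℤ} (hl : l ≠ 0) {F : ℝ → ℝ} (hF : Integrable F)
    (hs : Summable fun k : ℤ => ∫ a, F ((k : ℝ) / l + a) ∂unitMeasure) :
    ∑' k : ℤ, ∫ a, F ((k : ℝ) / l + a) ∂unitMeasure = |(l : ℝ)| * ∫ x, F x := by
  have : NeZero l.natAbs := ⟨Int.natAbs_ne_zero.2 hl⟩
  have hl0 : (l : ℝ) ≠ 0 := Int.cast_ne_zero.2 hl
  have habs : ((l.natAbs : ℕ) : ℝ) = |(l : ℝ)| := Nat.cast_natAbs l |>.trans (by simp)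
  let e : ℤ ≃ Fin l.natAbs × ℤ := (Int.divModEquiv l.natAbs).trans (Equiv.prodComm _ _)
  have he (p : Fin l.natAbs × ℤ) : e.symm p = p.2 * l.natAbs + p.1 := rfl
  have hsg : |(l : ℝ)| / l = 1 ∨ |(l : ℝ)| / l = -1 := by
    rcases abs_choice (l : ℝ) with h | h <;> rw [h]
    · exact .inl (div_self hl0)
    · exact .inr (by rw [neg_div, div_self hl0])
  rw [← e.symm.tsum_eq]
  refine ((e.symm.summable_iff.2 hs).tsum_prod).trans ?_
  simp only [Function.comp_apply]
  have h1 (r : Fin l.natAbs) :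
      ∑' m : ℤ, ∫ a, F (((e.symm (r, m) : ℤ) : ℝ) / l + a) ∂unitMeasure = ∫ x, F x := by
    rw [← (hasSum_translates_sign hF ((r : ℝ) / l) hsg).tsum_eq]
    refine tsum_congr fun m => ?_
    have : ((e.symm (r, m) : ℤ) : ℝ) / l = (r : ℝ) / l + |(l : ℝ)| / l * m := by
      rw [he, Int.cast_add, Int.cast_mul, Int.cast_natCast, Int.cast_natCast, habs]
      ring
    rw [this]
  simp only [h1]
  simp [habs]

/-! ### The transform is isometric -/

theorem continuous_bwzLift {l : ℤ} (hl : l ≠ 0) (q : ℤ) (h : 𝓢(ℝ, ℂ)) :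
    Continuous fun p : ℝ × ℝ × ℝ => bwzLift l q h (Heis.ofProd p) := by
  have hs : ContDiff ℝ ∞ fun p : ℝ × ℝ × ℝ => bwz l q h (mk (Heis.ofProd p)) := smoothOnM_bwz hl q h
  have hc := hs.continuous
  simp only [bwz_mk hl] at hc
  exact hc

theorem measurable_bwz {l : ℤ} (hl : l ≠ 0) (q : ℤ) (h : 𝓢(ℝ, ℂ)) : Measurable (bwz l q h) := by
  refine measurable_of_lift ?_
  simp only [bwz_mk hl]
  have hm := (continuous_bwzLift hl q h).measurable
  have hx (x : Heis) : Heis.ofProd (Heis.equivProd x) = x := rfl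
  simpa only [Function.comp_def, hx] using hm.comp Heis.measurable_equivProd

/-- The samples of `h` occurring in the `k`-th term of the transform. -/
def bwzSample (l q : ℤ) (h : 𝓢(ℝ, ℂ)) (k : ℤ) (a : ℝ) : ℂ :=
  expo (-q) ((k : ℝ) / l) * h ((k : ℝ) / l + a)

theorem norm_bwzSample (l q : ℤ) (h : 𝓢(ℝ, ℂ)) (k : ℤ) (a : ℝ) :
    ‖bwzSample l q h k a‖ = ‖h ((k : ℝ) / l + a)‖ := by
  simp [bwzSample, norm_expo]

theorem continuous_bwzSample (l q : ℤ) (h : 𝓢(ℝ, ℂ)) (k : ℤ) : Continuous (bwzSample l q h k) :=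
  continuous_const.mul (h.continuous.comp (continuous_const.add continuous_id))

theorem cellMode_bwzSample (l q : ℤ) (h : 𝓢(ℝ, ℂ)) (k : ℤ) (m : M) :
    cellMode k l (bwzSample l q h k) m = bwzTerm l q h (rep m) k := by
  rw [cellMode, bwzSample, bwzTerm_eq]
  ring

theorem exists_bwzSample_bound {l : ℤ} (hl : l ≠ 0) (q : ℤ) (h : 𝓢(ℝ, ℂ)) :
    ∃ u : ℤ → ℝ, Summable u ∧ ∀ k, ∀ a ∈ Set.Ico (0 : ℝ) 1, ‖bwzSample l q h k a‖ ≤ u k := by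
  obtain ⟨C, hC⟩ := exists_sample_bound hl h 0 1
  refine ⟨_, summable_inv_one_add_abs_sq.mul_left C, fun k a ha => ?_⟩
  rw [norm_bwzSample]
  simpa using hC k a (abs_le.2 ⟨by linarith [ha.1], ha.2.le⟩)

theorem memLp_bwzSample {l : ℤ} (hl : l ≠ 0) (q : ℤ) (h : 𝓢(ℝ, ℂ)) (k : ℤ) :
    MemLp (cellMode k l (bwzSample l q h k)) 2 muM := by
  obtain ⟨u, -, hu⟩ := exists_bwzSample_bound hl q h
  exact memLp_cellMode k l (continuous_bwzSample l q h k).measurable (hu k) 2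

/-- On the cube the transform is a series of cell modes with distinct frequencies in `b`, hence with
pairwise orthogonal terms. -/
theorem bwz_eq_tsum {l : ℤ} (hl : l ≠ 0) (q : ℤ) (h : 𝓢(ℝ, ℂ)) (m : M) :
    bwz l q h m = bwzConst l * ∑' k, cellMode k l (bwzSample l q h k) m := by
  simp only [cellMode_bwzSample]
  conv_lhs => rw [← mk_rep m, bwz_mk hl]
  rfl

theorem bwzConst_ne_zero {l : ℤ} (hl : l ≠ 0) : bwzConst l ≠ 0 := by
  have hl0 : (l : ℝ) ≠ 0 := Int.cast_ne_zero.2 hl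
  exact Complex.ofReal_ne_zero.2 (div_ne_zero (Real.sqrt_ne_zero'.2 (abs_pos.2 hl0)) hl0)

theorem norm_bwzConst_sq_mul {l : ℤ} (hl : l ≠ 0) : ‖bwzConst l‖ ^ 2 * |(l : ℝ)| = 1 := by
  have hl0 : 0 < |(l : ℝ)| := abs_pos.2 (Int.cast_ne_zero.2 hl)
  rw [bwzConst, Complex.norm_real, Real.norm_eq_abs, sq_abs, div_pow, Real.sq_sqrt hl0.le,
    ← sq_abs (l : ℝ)]
  field_simp

theorem memLp_bwz {l : ℤ} (hl : l ≠ 0) (q : ℤ) (h : 𝓢(ℝ, ℂ)) : MemLp (bwz l q h) 2 muM := by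
  obtain ⟨u, hu, hb⟩ := exists_bwzSample_bound hl q h
  refine MemLp.of_bound (measurable_bwz hl q h).aestronglyMeasurable (‖bwzConst l‖ * ∑' k, u k)
    (.of_forall fun m => ?_)
  rw [bwz_eq_tsum hl, norm_mul]
  refine mul_le_mul_of_nonneg_left (tsum_of_norm_bounded hu.hasSum fun k => ?_) (norm_nonneg _)
  rw [norm_cellMode]
  exact hb k _ (rep_mem_cube m).1

theorem bwz_mem_centralMode {l : ℤ} (hl : l ≠ 0) (q : ℤ) (h : 𝓢(ℝ, ℂ)) :
    (memLp_bwz hl q h).toLp ∈ centralMode l :=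
  mem_centralMode_iff.2 ⟨_, MemLp.coeFn_toLp _, fun a b c => by
    simp only [bwz_mk hl, bwzLift_eq_zakSum]
    rw [expo_apply_zero]
    ring⟩

theorem norm_toLp_sq (h : 𝓢(ℝ, ℂ)) : ‖h.toLp 2 volume‖ ^ 2 = ∫ x, ‖h x‖ ^ 2 := by
  have h1 := SchwartzMap.inner_toL2_toL2_eq h h volume
  have h2 := inner_self_eq_norm_sq (𝕜 := ℂ) (h.toLp 2 (volume : Measure ℝ))
  rw [h1] at h2
  have h3 (x : ℝ) : inner ℂ (h x) (h x) = ((‖h x‖ ^ 2 : ℝ) : ℂ) := by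
    rw [inner_self_eq_norm_sq_to_K]; simp
  simp only [h3] at h2
  rw [integral_complex_ofReal] at h2
  simpa using h2.symm

theorem norm_cellMode_toLp_sq {k l : ℤ} {φ : ℝ → ℂ} (hφ : MemLp (cellMode k l φ) 2 muM) :
    ‖hφ.toLp‖ ^ 2 = ∫ a, ‖φ a‖ ^ 2 ∂unitMeasure := by
  have h2 := inner_self_eq_norm_sq (𝕜 := ℂ) hφ.toLp
  rw [inner_cellMode_cellMode] at h2
  have h3 (x : ℝ) : starRingEnd ℂ (φ x) * φ x = ((‖φ x‖ ^ 2 : ℝ) : ℂ) := by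
    rw [mul_comm, Complex.mul_conj, Complex.normSq_eq_norm_sq]
  simp only [h3] at h2
  rw [integral_complex_ofReal] at h2
  simpa using h2.symm

/-- Pythagoras turns the squared norm into a sum of integrals of `|h|²` over the intervals `k / l +
[0,1)`. By `tsum_samples` that sum is `|l|` times the integral over the line, and the squared
constant is `1 / |l|`. -/
theorem norm_bwz_toLp {l : ℤ} (hl : l ≠ 0) (q : ℤ) (h : 𝓢(ℝ, ℂ)) :
    ‖(memLp_bwz hl q h).toLp‖ = ‖h.toLp 2 volume‖ := by
  obtain ⟨u, hu, hb⟩ := exists_bwzSample_bound hl q h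
  -- The constant is divided out so that the terms are exactly the cell modes.
  have hS := hasSum_toLp (memLp_bwzSample hl q h) hu (fun k m => by
    rw [norm_cellMode]; exact hb k _ (rep_mem_cube m).1)
    (F := fun m => (bwzConst l)⁻¹ * bwz l q h m) ((memLp_bwz hl q h).const_mul _) (fun m => by
      rw [bwz_eq_tsum hl, inv_mul_cancel_left₀ (bwzConst_ne_zero hl)])
  have hN := hasSum_norm_sq_of_orthogonal hS fun i j hij => by
    rw [inner_cellMode_cellMode, if_neg hij, zero_mul, mul_zero]
  simp only [norm_cellMode_toLp_sq, norm_bwzSample] at hN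
  have hint : Integrable fun x => ‖h x‖ ^ 2 :=
    (h.memLp 2 volume).integrable_norm_pow (by norm_num)
  have h1 := tsum_samples hl hint hN.summable
  rw [hN.tsum_eq, ← norm_toLp_sq] at h1
  have h2 : ‖((memLp_bwz hl q h).const_mul (bwzConst l)⁻¹).toLp‖ =
      ‖bwzConst l‖⁻¹ * ‖(memLp_bwz hl q h).toLp‖ := by
    have := MemLp.toLp_const_smul (bwzConst l)⁻¹ (memLp_bwz hl q h)
    rw [← norm_inv, ← norm_smul, ← this]
    rfl
  rw [h2] at h1
  have hc : 0 < ‖bwzConst l‖ := norm_pos_iff.2 (bwzConst_ne_zero hl)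
  have h3 := norm_bwzConst_sq_mul hl
  refine (pow_left_inj₀ (norm_nonneg _) (norm_nonneg _) two_ne_zero).1 ?_
  rw [mul_pow, inv_pow, inv_mul_eq_iff_eq_mul₀ (by positivity)] at h1
  rw [h1, ← mul_assoc, h3, one_mul]

/-! ### The isometric extension of the transform -/

theorem denseRange_schwartz_toLp :
    DenseRange fun h : 𝓢(ℝ, ℂ) => (h.toLp 2 volume : L2R) :=
  SchwartzMap.denseRange_toLpCLM (F := ℂ) (p := 2) (μ := (volume : Measure ℝ)) (by norm_num)

/-- Two continuous maps on `L²(ℝ)` agreeing on Schwartz functions are equal. -/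
theorem eq_of_eq_on_schwartz {X : Type*} [TopologicalSpace X] [T2Space X] {S T : L2R → X}
    (hS : Continuous S) (hT : Continuous T)
    (h : ∀ φ : 𝓢(ℝ, ℂ), S (φ.toLp 2 volume) = T (φ.toLp 2 volume)) (f : L2R) : S f = T f :=
  congrFun (denseRange_schwartz_toLp.equalizer hS hT (funext h)) f

theorem bwz_add {l : ℤ} (hl : l ≠ 0) (q : ℤ) (h h' : 𝓢(ℝ, ℂ)) :
    bwz l q (h + h') = bwz l q h + bwz l q h' := by
  funext m
  obtain ⟨x, rfl⟩ := mk_surjective m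
  simp only [Pi.add_apply, bwz_mk hl, bwzLift_eq_tsum, ← mul_add]
  rw [← (summable_bwzTerm hl q h x).tsum_add (summable_bwzTerm hl q h' x)]
  congr 2
  funext k
  simp only [bwzTerm, add_apply, mul_add]

theorem bwz_smul {l : ℤ} (hl : l ≠ 0) (q : ℤ) (z : ℂ) (h : 𝓢(ℝ, ℂ)) :
    bwz l q (z • h) = z • bwz l q h := by
  funext m
  obtain ⟨x, rfl⟩ := mk_surjective m
  simp only [Pi.smul_apply, bwz_mk hl, bwzLift_eq_tsum, smul_eq_mul]
  rw [mul_left_comm, ← tsum_mul_left (a := z)]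
  congr 2
  funext k
  simp only [bwzTerm, smul_apply, smul_eq_mul]
  ring

/-- The transform as a linear map from the Schwartz space to `L²(M)`. -/
def bwzLin {l : ℤ} (hl : l ≠ 0) (q : ℤ) : 𝓢(ℝ, ℂ) →ₗ[ℂ] L2M where
  toFun h := (memLp_bwz hl q h).toLp
  map_add' h h' := by
    rw [← MemLp.toLp_add]
    simp only [bwz_add hl]
  map_smul' z h := by
    rw [RingHom.id_apply, ← MemLp.toLp_const_smul]
    simp only [bwz_smul hl]

/-- The isometric extension of the Berezin–Weil–Zak transform to `L²(ℝ)`. -/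
def bwzIso {l : ℤ} (hl : l ≠ 0) (q : ℤ) : L2R →ₗᵢ[ℂ] L2M :=
  have hext (h : 𝓢(ℝ, ℂ)) : (bwzLin hl q).extendOfNorm
      (SchwartzMap.toLpCLM ℂ ℂ 2 (volume : Measure ℝ)).toLinearMap (h.toLp 2 volume) =
      bwzLin hl q h :=
    LinearMap.extendOfNorm_eq (e := (SchwartzMap.toLpCLM ℂ ℂ 2 (volume : Measure ℝ)).toLinearMap)
      denseRange_schwartz_toLp ⟨1, fun h => by
        rw [one_mul]; exact (norm_bwz_toLp hl q h).le⟩ h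
  { toLinearMap := ((bwzLin hl q).extendOfNorm
      (SchwartzMap.toLpCLM ℂ ℂ 2 (volume : Measure ℝ)).toLinearMap).toLinearMap
    norm_map' := fun f => eq_of_eq_on_schwartz
      ((bwzLin hl q).extendOfNorm _).continuous.norm continuous_norm
      (fun h => (congrArg norm (hext h)).trans (norm_bwz_toLp hl q h)) f }

theorem bwzIso_toLp {l : ℤ} (hl : l ≠ 0) (q : ℤ) (h : 𝓢(ℝ, ℂ)) :
    bwzIso hl q (h.toLp 2 volume) = (memLp_bwz hl q h).toLp :=
  LinearMap.extendOfNorm_eq (e := (SchwartzMap.toLpCLM ℂ ℂ 2 (volume : Measure ℝ)).toLinearMap)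
    denseRange_schwartz_toLp ⟨1, fun h => by
      rw [one_mul]; exact (norm_bwz_toLp hl q h).le⟩ h

theorem coeFn_bwzIso_toLp {l : ℤ} (hl : l ≠ 0) (q : ℤ) (h : 𝓢(ℝ, ℂ)) :
    (bwzIso hl q (h.toLp 2 volume) : M → ℂ) =ᵐ[muM] bwz l q h := by
  rw [bwzIso_toLp]
  exact MemLp.coeFn_toLp _

theorem bwzIso_unique {l : ℤ} (hl : l ≠ 0) (q : ℤ) (T : L2R →L[ℂ] L2M)
    (hT : ∀ h : 𝓢(ℝ, ℂ), (T (h.toLp 2 volume) : M → ℂ) =ᵐ[muM] bwz l q h) :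
    T = (bwzIso hl q).toContinuousLinearMap :=
  ContinuousLinearMap.ext (eq_of_eq_on_schwartz T.continuous (bwzIso hl q).continuous fun h =>
    Lp.ext ((hT h).trans (coeFn_bwzIso_toLp hl q h).symm))

theorem bwzIso_periodic {l : ℤ} (hl : l ≠ 0) (q m : ℤ) :
    bwzIso hl (l * m + q) = bwzIso hl q :=
  LinearIsometry.ext (eq_of_eq_on_schwartz (bwzIso hl _).continuous (bwzIso hl q).continuous
    fun h => Lp.ext ((coeFn_bwzIso_toLp hl _ h).trans (by
      rw [bwz_periodic hl]
      exact (coeFn_bwzIso_toLp hl q h).symm)))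

theorem bwzIso_mem {l : ℤ} (hl : l ≠ 0) (q : ℤ) (f : L2R) : bwzIso hl q f ∈ centralMode l := by
  refine denseRange_schwartz_toLp.induction_on (p := fun f => bwzIso hl q f ∈ centralMode l) f
    ((isClosed_centralMode l).preimage (bwzIso hl q).continuous) fun h => ?_
  rw [bwzIso_toLp]
  exact bwz_mem_centralMode hl q h

theorem bwzIso_schrodinger {l : ℤ} (hl : l ≠ 0) (q : ℤ) (g : Heis) (f : L2R) :
    bwzIso hl q (schrodinger l g f) = regRep g (bwzIso hl q f) := by
  refine eq_of_eq_on_schwartz ((bwzIso hl q).continuous.comp (schrodinger l g).continuous)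
    ((regRep g).continuous.comp (bwzIso hl q).continuous) (fun h => ?_) f
  obtain ⟨h', hh⟩ := exists_schwartz_schrodinger l g h
  have h1 : schrodinger l g (h.toLp 2 volume) = h'.toLp 2 volume := by
    refine Lp.ext ((coeFn_schrodinger _ _ _).trans ?_)
    filter_upwards [h'.coeFn_toLp 2 volume, (measurePreserving_add_right volume
      g.a).quasiMeasurePreserving.ae_eq_comp (h.coeFn_toLp 2 volume)] with u h1 h2
    simp only [Function.comp_apply] at h2
    rw [h1, hh, h2]
  change bwzIso hl q (schrodinger l g (h.toLp 2 volume)) =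
    regRep g (bwzIso hl q (h.toLp 2 volume))
  rw [h1]
  refine Lp.ext ((coeFn_bwzIso_toLp hl q h').trans ?_)
  filter_upwards [coeFn_regRep g (bwzIso hl q (h.toLp 2 volume)),
    (mp_rmul g).quasiMeasurePreserving.ae_eq_comp (coeFn_bwzIso_toLp hl q h)] with m h1 h2
  simp only [Function.comp_apply] at h2
  rw [h1, h2, bwz_schrodinger hl q hh]

/-! ### Translation formulas on `L²(ℝ)`. -/

theorem memLp_chi_mul (w : ℤ × ℤ) (f : L2M) :
    MemLp (fun m => chi w m * (f : M → ℂ) m) 2 muM :=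
  (Lp.memLp f).of_le ((measurable_chi w).aestronglyMeasurable.mul (Lp.aestronglyMeasurable f))
    (.of_forall fun m => by simp [norm_chi])

/-- Multiplication by the character `χ_w` on `L²(M)`. -/
def mulChi (w : ℤ × ℤ) : L2M →ₗᵢ[ℂ] L2M :=
  { toFun := fun f => (memLp_chi_mul w f).toLp
    map_add' := fun f f' => by
      rw [← MemLp.toLp_add, MemLp.toLp_eq_toLp_iff]
      filter_upwards [Lp.coeFn_add f f'] with m h
      simp only [Pi.add_apply] at h ⊢
      rw [h, mul_add]
    map_smul' := fun z f => by
      rw [RingHom.id_apply, ← MemLp.toLp_const_smul, MemLp.toLp_eq_toLp_iff]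
      filter_upwards [Lp.coeFn_smul z f] with m h
      simp only [Pi.smul_apply, smul_eq_mul] at h ⊢
      rw [h]
      ring
    norm_map' := fun f => by
      change ‖(memLp_chi_mul w f).toLp‖ = ‖f‖
      rw [Lp.norm_toLp, Lp.norm_def]
      congr 1
      exact eLpNorm_congr_norm_ae (.of_forall fun m => by simp [norm_chi]) }

theorem coeFn_mulChi (w : ℤ × ℤ) (f : L2M) :
    (mulChi w f : M → ℂ) =ᵐ[muM] fun m => chi w m * (f : M → ℂ) m :=
  (memLp_chi_mul w f).coeFn_toLp

theorem mulChi_mulChi_neg (w : ℤ × ℤ) (f : L2M) : mulChi w (mulChi (-w) f) = f := by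
  refine Lp.ext ?_
  filter_upwards [coeFn_mulChi w (mulChi (-w) f), coeFn_mulChi (-w) f] with m h1 h2
  obtain ⟨x, rfl⟩ := mk_surjective m
  have h3 := expo_mul_expo w.1 (-w.1) x.a
  have h4 := expo_mul_expo w.2 (-w.2) x.b
  rw [add_neg_cancel, expo_zero] at h3 h4
  rw [h1, h2, chi_mk, chi_mk, chiLift_eq, chiLift_eq, Prod.fst_neg, Prod.snd_neg]
  linear_combination (f : M → ℂ) (mk x) * (expo w.2 x.b * expo (-w.2) x.b * h3 + h4)

/-- Stated as an identity of continuous operators, with the phase in `b` as `mulChi`, so that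
density applies; the almost everywhere formula is read off afterwards. -/
theorem regRep_a_bwzIso {l : ℤ} (hl : l ≠ 0) (q₀ q : ℤ) (f : L2R) :
    regRep ⟨q / l, 0, 0⟩ (bwzIso hl q₀ f) =
      expo q₀ ((q : ℝ) / l) • mulChi (0, -q) (bwzIso hl q₀ f) := by
  refine eq_of_eq_on_schwartz ((regRep _).continuous.comp (bwzIso hl q₀).continuous)
    (((mulChi _).continuous.comp (bwzIso hl q₀).continuous).const_smul (expo q₀ ((q : ℝ) / l))) (fun h => ?_) f
  change regRep ⟨q / l, 0, 0⟩ (bwzIso hl q₀ (h.toLp 2 volume)) =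
    expo q₀ ((q : ℝ) / l) • mulChi (0, -q) (bwzIso hl q₀ (h.toLp 2 volume))
  refine Lp.ext ?_
  filter_upwards [coeFn_regRep ⟨q / l, 0, 0⟩ (bwzIso hl q₀ (h.toLp 2 volume)),
    (mp_rmul ⟨q / l, 0, 0⟩).quasiMeasurePreserving.ae_eq_comp (coeFn_bwzIso_toLp hl q₀ h),
    coeFn_bwzIso_toLp hl q₀ h, coeFn_mulChi (0, -q) (bwzIso hl q₀ (h.toLp 2 volume)),
    Lp.coeFn_smul (expo q₀ ((q : ℝ) / l)) (mulChi (0, -q) (bwzIso hl q₀ (h.toLp 2 volume)))]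
    with m h1 h2 h3 h4 h5
  simp only [Function.comp_apply] at h2 ⊢
  rw [h1, h2, h5, Pi.smul_apply, h4, h3]
  obtain ⟨x, rfl⟩ := mk_surjective m
  rw [chi_mk, chiLift_eq, expo_zero, one_mul, smul_eq_mul]
  refine (bwz_rmul_a hl q₀ q h x.a x.b x.c).trans ?_
  ring

theorem regRep_b_bwzIso {l : ℤ} (hl : l ≠ 0) (q₀ q : ℤ) (f : L2R) :
    regRep ⟨0, q / l, 0⟩ (bwzIso hl q₀ f) = mulChi (q, 0) (bwzIso hl (q₀ - q) f) := by
  refine eq_of_eq_on_schwartz ((regRep _).continuous.comp (bwzIso hl q₀).continuous)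
    ((mulChi _).continuous.comp (bwzIso hl (q₀ - q)).continuous) (fun h => ?_) f
  refine Lp.ext ?_
  filter_upwards [coeFn_regRep ⟨0, q / l, 0⟩ (bwzIso hl q₀ (h.toLp 2 volume)),
    (mp_rmul ⟨0, q / l, 0⟩).quasiMeasurePreserving.ae_eq_comp (coeFn_bwzIso_toLp hl q₀ h),
    coeFn_bwzIso_toLp hl (q₀ - q) h,
    coeFn_mulChi (q, 0) (bwzIso hl (q₀ - q) (h.toLp 2 volume))] with m h1 h2 h3 h4
  simp only [Function.comp_apply] at h2 ⊢
  rw [h1, h2, h4, h3]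
  obtain ⟨x, rfl⟩ := mk_surjective m
  rw [chi_mk, chiLift_eq, expo_zero, mul_one]
  exact bwz_rmul_b hl q₀ q h x.a x.b x.c

theorem ae_bwzIso_translate {l : ℤ} (hl : l ≠ 0) (q₀ q : ℤ) (f : L2R) :
    ∀ᵐ m ∂muM,
      (bwzIso hl q₀ f : M → ℂ) (rmul ⟨q / l, 0, 0⟩ m) =
        chi (0, -q) m * expo q₀ ((q : ℝ) / l) * (bwzIso hl q₀ f : M → ℂ) m ∧
      (bwzIso hl q₀ f : M → ℂ) (rmul ⟨0, q / l, 0⟩ m) =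
        chi (q, 0) m * (bwzIso hl (q₀ - q) f : M → ℂ) m := by
  have h1 := coeFn_regRep ⟨q / l, 0, 0⟩ (bwzIso hl q₀ f)
  have h2 := coeFn_regRep ⟨0, q / l, 0⟩ (bwzIso hl q₀ f)
  rw [regRep_a_bwzIso] at h1
  rw [regRep_b_bwzIso] at h2
  filter_upwards [h1, h2, coeFn_mulChi (0, -q) (bwzIso hl q₀ f),
    coeFn_mulChi (q, 0) (bwzIso hl (q₀ - q) f),
    Lp.coeFn_smul (expo q₀ ((q : ℝ) / l)) (mulChi (0, -q) (bwzIso hl q₀ f))] with m h1 h2 h3 h4 h5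
  constructor
  · rw [← h1, h5, Pi.smul_apply, h3, smul_eq_mul]
    ring
  · rw [← h2, h4]

/-! ### Decomposition of the mode `l` -/

theorem expo_ne_expo {l : ℤ} (hl : l ≠ 0) {q q' : ℤ} (h : ¬ l ∣ q - q') :
    expo q ((1 : ℝ) / l) ≠ expo q' ((1 : ℝ) / l) := fun he => by
  have hl0 : (l : ℂ) ≠ 0 := Int.cast_ne_zero.2 hl
  obtain ⟨n, hn⟩ := Complex.exp_eq_exp_iff_exists_int.1 he
  refine h ⟨n, ?_⟩
  have h1 : (2 * Real.pi * Complex.I) * ((q : ℂ) - q') =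
      (2 * Real.pi * Complex.I) * (l * n) := by
    push_cast at hn
    field_simp at hn
    linear_combination (2 * Real.pi * Complex.I) * hn
  have := mul_left_cancel₀ Complex.two_pi_I_ne_zero h1
  exact_mod_cast this

/-- The inner-product preserving map `T` undoes by a character the phase `e^{-2πib}` that
translation by `1 / l` creates. The ranges are then eigenspaces, with eigenvalues `e^{2πiq/l}` that
differ for different residues of `q`. -/
theorem inner_bwzIso {l : ℤ} (hl : l ≠ 0) {q q' : ℤ} (h : ¬ l ∣ q - q') (f f' : L2R) :
    inner ℂ (bwzIso hl q f) (bwzIso hl q' f') = 0 := by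
  let T : L2M → L2M := fun x => mulChi (0, 1) (regRep ⟨(1 : ℤ) / l, 0, 0⟩ x)
  have hT (q : ℤ) (f : L2R) : T (bwzIso hl q f) = expo q ((1 : ℝ) / l) • bwzIso hl q f := by
    change mulChi (0, 1) (regRep _ _) = _
    rw [regRep_a_bwzIso hl q 1 f, map_smul]
    have := mulChi_mulChi_neg (0, 1) (bwzIso hl q f)
    rw [show -((0 : ℤ), (1 : ℤ)) = (0, -1) by simp] at this
    rw [this, Int.cast_one]
  refine inner_eq_zero_of_eigen (T := T) (fun x y => ?_) (norm_expo _ _) (expo_ne_expo hl h)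
    (hT q f) (hT q' f')
  exact (LinearIsometry.inner_map_map _ _ _).trans (LinearIsometryEquiv.inner_map_map _ _ _)

/-- A full geometric sum of powers of a nontrivial `|l|`-th root of unity. -/
theorem sum_expo_eq_zero {l : ℤ} (hl : l ≠ 0) {m : ℤ} (h : ¬ l ∣ m) :
    ∑ q ∈ Finset.range l.natAbs, expo q ((m : ℝ) / l) = 0 := by
  have hl0 : (l : ℝ) ≠ 0 := Int.cast_ne_zero.2 hl
  have hpow (q : ℕ) : expo q ((m : ℝ) / l) = expo 1 ((m : ℝ) / l) ^ q := by
    rw [expo, expo, ← Complex.exp_nat_mul]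
    congr 1
    push_cast
    ring
  have hne : expo 1 ((m : ℝ) / l) ≠ 1 := by
    have := expo_ne_expo hl (q := m) (q' := 0) (by simpa using h)
    rw [expo_zero] at this
    have h1 := expo_div_comm 1 m l
    rw [Int.cast_one] at h1
    rwa [h1]
  simp only [hpow]
  rw [geom_sum_eq hne, ← hpow]
  have : expo (l.natAbs : ℤ) ((m : ℝ) / l) = 1 := by
    rcases Int.natAbs_eq l with h | h
    · rw [← h]
      simpa using expo_mul_div hl 1 m
    · rw [show (l.natAbs : ℤ) = l * (-1) by omega]
      exact expo_mul_div hl (-1) m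
  rw [this, sub_self, zero_div]

/-- Finite Fourier inversion over `q` isolates a single term of the transform of a function
supported in an interval of length one. -/
theorem sum_bwz_eq_cellMode {l : ℤ} (hl : l ≠ 0) (k₀ : ℤ) {φ h : 𝓢(ℝ, ℂ)}
    (hφ : ∀ u, u ∉ Set.Ioo (0 : ℝ) 1 → φ u = 0) (hh : ∀ u, h u = φ (u - (k₀ : ℝ) / l)) (m : M) :
    ∑ q ∈ Finset.range l.natAbs, expo q ((k₀ : ℝ) / l) * bwz l q h m =
      (bwzConst l * l.natAbs) * cellMode k₀ l φ m := by
  have hl0 : (l : ℝ) ≠ 0 := Int.cast_ne_zero.2 hl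
  set x := rep m with hx
  have hm : mk x = m := mk_rep m
  have hmem := rep_mem_cube m
  have hterm (q : ℕ) (k : ℤ) : expo q ((k₀ : ℝ) / l) * bwzTerm l q h x k =
      expo q (((k₀ - k : ℤ) : ℝ) / l) *
        ((expo l x.c * expo k x.b) * φ (((k - k₀ : ℤ) : ℝ) / l + x.a)) := by
    have e1 : ((k₀ - k : ℤ) : ℝ) / l = k₀ / l + -(k / l) := by push_cast; ring
    have e2 : (k : ℝ) / l + x.a - k₀ / l = ((k - k₀ : ℤ) : ℝ) / l + x.a := by push_cast; ring
    have e3 : expo q (-((k : ℝ) / l)) = expo (-q) ((k : ℝ) / l) := by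
      unfold expo; push_cast; ring_nf
    rw [bwzTerm_eq, hh, e1, e2, expo_add, e3]
    ring
  have hsum (q : ℕ) : Summable fun k : ℤ => expo q (((k₀ - k : ℤ) : ℝ) / l) *
        ((expo l x.c * expo k x.b) * φ (((k - k₀ : ℤ) : ℝ) / l + x.a)) := by
    simpa only [hterm] using (summable_bwzTerm hl q h x).mul_left (expo q ((k₀ : ℝ) / l))
  have h1 (q : ℕ) : expo q ((k₀ : ℝ) / l) * bwz l q h m =
      bwzConst l * ∑' k, expo q (((k₀ - k : ℤ) : ℝ) / l) *
        ((expo l x.c * expo k x.b) * φ (((k - k₀ : ℤ) : ℝ) / l + x.a)) := by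
    rw [← hm, bwz_mk hl, bwzLift_eq_tsum, mul_left_comm, ← tsum_mul_left]
    simp only [hterm]
  simp only [h1]
  -- With the sum over `q` inside, indices not congruent to `k₀` modulo `l` cancel by orthogonality
  -- of roots of unity.
  rw [← Finset.mul_sum, ← Summable.tsum_finsetSum fun q _ => hsum q]
  simp only [← Finset.sum_mul]
  rw [tsum_eq_single k₀]
  · rw [cellMode, ← hx]
    simp only [sub_self, Int.cast_zero, zero_div, zero_add, expo_apply_zero, Finset.sum_const,
      Finset.card_range, nsmul_eq_mul, mul_one]
    ring
  · intro k hk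
    by_cases hd : l ∣ k - k₀
    · obtain ⟨j, hj⟩ := hd
      have hj0 : j ≠ 0 := by
        rintro rfl
        exact hk (by linarith)
      have e : ((k - k₀ : ℤ) : ℝ) / l = j := by rw [hj]; push_cast; field_simp
      -- The other indices congruent to `k₀` displace `a ∈ [0,1)` by a nonzero integer `j`, out of
      -- the support of `φ`.
      rw [e, hφ _ fun hu => ?_, mul_zero, mul_zero]
      have h2 : (-1 : ℝ) < j := by linarith [hu.1, hmem.1.2]
      have h3 : (j : ℝ) < 1 := by linarith [hu.2, hmem.1.1]
      have h2' : -1 < j := by exact_mod_cast h2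
      have h3' : j < 1 := by exact_mod_cast h3
      omega
    · rw [sum_expo_eq_zero hl (fun hd' => hd ((dvd_sub_comm).1 hd')), zero_mul]

/-- Applied to the translate of `φ` by `k₀ / l`, the finite Fourier sum writes the cell mode as a
combination of transforms. -/
theorem inner_cellMode_eq_zero {l : ℤ} (hl : l ≠ 0) {f : L2M}
    (hf : ∀ (q : ℤ) (h : 𝓢(ℝ, ℂ)), inner ℂ (memLp_bwz hl q h).toLp f = 0) (k₀ : ℤ) {φ : 𝓢(ℝ, ℂ)}
    (hφ : ∀ u, u ∉ Set.Ioo (0 : ℝ) 1 → φ u = 0) (hm : MemLp (cellMode k₀ l φ) 2 muM) :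
    inner ℂ hm.toLp f = 0 := by
  set h : 𝓢(ℝ, ℂ) := SchwartzMap.compSubConstCLM ℂ ((k₀ : ℝ) / l) φ
  have hc : bwzConst l * (l.natAbs : ℂ) ≠ 0 :=
    mul_ne_zero (bwzConst_ne_zero hl) (Nat.cast_ne_zero.2 (Int.natAbs_ne_zero.2 hl))
  have hv (q : ℕ) : MemLp (fun m => expo q ((k₀ : ℝ) / l) * bwz l q h m) 2 muM :=
    (memLp_bwz hl q h).const_mul _
  have h1 : ∑ q ∈ Finset.range l.natAbs, (hv q).toLp = (bwzConst l * (l.natAbs : ℂ)) • hm.toLp := by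
    refine Lp.ext ((coeFn_sum_toLp hv _).trans ?_)
    filter_upwards [Lp.coeFn_smul (bwzConst l * (l.natAbs : ℂ)) hm.toLp, hm.coeFn_toLp] with m e1 e2
    rw [e1, Pi.smul_apply, e2, smul_eq_mul, sum_bwz_eq_cellMode hl k₀ hφ fun u => rfl]
  have h2 : inner ℂ ((bwzConst l * (l.natAbs : ℂ)) • hm.toLp) f = 0 := by
    rw [← h1, sum_inner]
    refine Finset.sum_eq_zero fun q _ => ?_
    have : (hv q).toLp = expo q ((k₀ : ℝ) / l) • (memLp_bwz hl q h).toLp :=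
      MemLp.toLp_const_smul (expo q ((k₀ : ℝ) / l)) (memLp_bwz hl q h)
    rw [this, inner_smul_left, hf, mul_zero]
  rw [inner_smul_left] at h2
  exact (mul_eq_zero.1 h2).resolve_left ((map_ne_zero _).2 hc)

/-- An element of the mode `l` orthogonal to the ranges of all transforms is zero. -/
theorem eq_zero_of_orthogonal_bwz {l : ℤ} (hl : l ≠ 0) {f : L2M} (hfl : f ∈ centralMode l)
    (hf : ∀ (q : ℤ) (h : 𝓢(ℝ, ℂ)), inner ℂ (memLp_bwz hl q h).toLp f = 0) : f = 0 := by
  refine eq_zero_of_mem_centralMode hfl fun j k => ?_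
  have hF : Integrable (fun p : ℝ × ℝ × ℝ => (expo (-k) p.2.1 * expo (-l) p.2.2) *
      (f : M → ℂ) (toM p)) cellMeasure := by
    have h1 : Integrable (fun p => (f : M → ℂ) (toM p)) cellMeasure :=
      (((Lp.memLp f).comp_measurePreserving mp_toM).integrable (by norm_num))
    exact h1.bdd_mul (c := 1) (Continuous.aestronglyMeasurable (by fun_prop))
      (.of_forall fun p => by simp [norm_expo])
  -- `G a` is the Fourier coefficient of `f` at frequency `(k, l)` in `(b, c)` with `a` held fixed.
  set G : ℝ → ℂ := fun a => ∫ p : ℝ × ℝ, (expo (-k) p.1 * expo (-l) p.2) *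
      (f : M → ℂ) (toM (a, p)) ∂(unitMeasure.prod unitMeasure) with hG
  have hGi : Integrable G unitMeasure := hF.integral_prod_left
  have key {φ : ℝ → ℂ} (hφc : Continuous φ) {C : ℝ} (hφ : ∀ t, ‖φ t‖ ≤ C)
      (hm : MemLp (cellMode k l φ) 2 muM) :
      inner ℂ hm.toLp f = ∫ a, starRingEnd ℂ (φ a) * G a ∂unitMeasure := by
    rw [inner_cellMode, integral_prod]
    · refine integral_congr_ae (.of_forall fun a => ?_)
      exact integral_const_mul (starRingEnd ℂ (φ a)) _
    · refine hF.bdd_mul (c := C) (Continuous.aestronglyMeasurable ?_)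
        (.of_forall fun p => by simpa using hφ p.1)
      exact Complex.continuous_conj.comp (hφc.comp continuous_fst)
  -- The finite Fourier sum only handles profiles supported in `(0,1)`; bump functions there suffice
  -- to make `G` vanish almost everywhere, and then every exponential profile is covered too.
  have hG0 : ∀ᵐ a ∂unitMeasure, a ∈ Set.Ioo (0 : ℝ) 1 → G a = 0 := by
    refine isOpen_Ioo.ae_eq_zero_of_integral_contDiff_smul_eq_zero
      (hGi.locallyIntegrable.locallyIntegrableOn _) fun g hg hgc hgs => ?_
    have hgc' : HasCompactSupport fun x => (g x : ℂ) := hgc.comp_left Complex.ofReal_zero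
    have hg' : ContDiff ℝ ∞ fun x => (g x : ℂ) := Complex.ofRealCLM.contDiff.comp hg
    set φ : 𝓢(ℝ, ℂ) := hgc'.toSchwartzMap hg' with hφ
    have hφ0 : ∀ u, u ∉ Set.Ioo (0 : ℝ) 1 → φ u = 0 := fun u hu => by
      have : g u = 0 := image_eq_zero_of_notMem_tsupport fun h => hu (hgs h)
      change (g u : ℂ) = 0
      rw [this, Complex.ofReal_zero]
    obtain ⟨C, hC⟩ := hgc'.exists_bound_of_continuous hg'.continuous
    have hm : MemLp (cellMode k l φ) 2 muM :=
      memLp_cellMode k l φ.continuous.measurable (fun t _ => hC t) 2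
    have := inner_cellMode_eq_zero hl hf k hφ0 hm
    rw [key φ.continuous hC] at this
    rw [← this]
    refine integral_congr_ae (.of_forall fun a => ?_)
    change g a • G a = starRingEnd ℂ (g a : ℂ) * G a
    rw [Complex.conj_ofReal, Complex.real_smul]
  have hIoo : ∀ᵐ a ∂unitMeasure, a ∈ Set.Ioo (0 : ℝ) 1 := by
    rw [unitMeasure, ← restrict_Ioo_eq_restrict_Ico]
    exact ae_restrict_mem measurableSet_Ioo
  rw [key (continuous_expo j) (fun t => (norm_expo j t).le)]
  refine integral_eq_zero_of_ae ?_
  filter_upwards [hG0, hIoo] with a h1 h2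
  simp [h1 h2]

/-! ### Indexing by residues and assembly of the decomposition. -/

/-- The transforms indexed by `ℤ / lℤ`. -/
def bwzMod {l : ℤ} (hl : l ≠ 0) (q : ZMod l.natAbs) : L2R →ₗᵢ[ℂ] L2M :=
  bwzIso hl (q.cast : ℤ)

theorem bwzMod_intCast {l : ℤ} (hl : l ≠ 0) (q : ℤ) : bwzMod hl (q : ZMod l.natAbs) = bwzIso hl q := by
  rw [bwzMod, ZMod.coe_intCast, ← bwzIso_periodic hl _ (q / l)]
  congr 1
  rw [Int.natCast_natAbs, Int.emod_abs]
  exact Int.mul_ediv_add_emod q l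

theorem isClosed_range_bwzMod {l : ℤ} (hl : l ≠ 0) (q : ZMod l.natAbs) :
    IsClosed (LinearMap.range (bwzMod hl q).toLinearMap : Set L2M) :=
  (bwzMod hl q).isometry.isClosedEmbedding.isClosed_range

theorem isOrthogonalDecomposition_bwzMod {l : ℤ} (hl : l ≠ 0) :
    IsOrthogonalDecomposition (fun q => LinearMap.range (bwzMod hl q).toLinearMap)
      (centralMode l) := by
  refine ⟨isClosed_range_bwzMod hl, ?_, ?_⟩
  · rintro q q' h ⟨_, f, rfl⟩ ⟨_, f', rfl⟩
    refine inner_bwzIso hl (fun hd => h ?_) f f'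
    have hd' : (l.natAbs : ℤ) ∣ (q.cast : ℤ) - (q'.cast : ℤ) := Int.natAbs_dvd.2 hd
    rw [← ZMod.intCast_zmod_cast q, ← ZMod.intCast_zmod_cast q']
    exact ((ZMod.intCast_eq_intCast_iff_dvd_sub _ _ _).2 hd').symm
  · refine eq_closure_iSup_of_orthogonal _ _ (isClosed_centralMode l) ?_ fun f hf h => ?_
    · rintro q _ ⟨f, rfl⟩
      exact bwzIso_mem hl _ f
    · refine eq_zero_of_orthogonal_bwz hl hf fun q φ => ?_
      refine h (q : ZMod l.natAbs) _ ⟨φ.toLp 2 volume, ?_⟩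
      change bwzMod hl (q : ZMod l.natAbs) _ = _
      rw [bwzMod_intCast, bwzIso_toLp]

theorem isInvariant_range_bwzMod {l : ℤ} (hl : l ≠ 0) (q : ZMod l.natAbs) :
    IsInvariant regRep (LinearMap.range (bwzMod hl q).toLinearMap) := by
  rintro g _ ⟨f, rfl⟩
  exact ⟨schrodinger l g f, bwzIso_schrodinger hl _ g f⟩

/-! ### The translation formulas in explicit exponentials. -/

theorem exp_neg_eq_expo (n : ℤ) (t : ℝ) :
    Complex.exp (-(2 * Real.pi * Complex.I * n * t)) = expo (-n) t := by
  unfold expo; push_cast; ring_nf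

theorem exp_div_eq_expo (n q l : ℤ) :
    Complex.exp (2 * Real.pi * Complex.I * n * (q / l)) = expo n ((q : ℝ) / l) := by
  unfold expo; push_cast; rfl

theorem bwz_translate {l : ℤ} (hl : l ≠ 0) (q₀ q : ℤ) (h : 𝓢(ℝ, ℂ)) (a b c : ℝ) :
    bwz l q₀ h (rmul ⟨q / l, 0, 0⟩ (mk ⟨a, b, c⟩)) =
      Complex.exp (-(2 * Real.pi * Complex.I * q * b)) *
        Complex.exp (2 * Real.pi * Complex.I * q₀ * (q / l)) * bwz l q₀ h (mk ⟨a, b, c⟩) ∧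
    bwz l q₀ h (rmul ⟨0, q / l, 0⟩ (mk ⟨a, b, c⟩)) =
      Complex.exp (2 * Real.pi * Complex.I * q * a) * bwz l (q₀ - q) h (mk ⟨a, b, c⟩) := by
  rw [exp_neg_eq_expo, exp_div_eq_expo]
  exact ⟨bwz_rmul_a hl q₀ q h a b c, bwz_rmul_b hl q₀ q h a b c⟩

theorem ae_bwzMod_translate {l : ℤ} (hl : l ≠ 0) (q₀ q : ℤ) (f : L2R) :
    ∀ᵐ p : ℝ × ℝ × ℝ,
      (bwzMod hl q₀ f : M → ℂ) (rmul ⟨q / l, 0, 0⟩ (mk ⟨p.1, p.2.1, p.2.2⟩)) =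
        Complex.exp (-(2 * Real.pi * Complex.I * q * p.2.1)) *
          Complex.exp (2 * Real.pi * Complex.I * q₀ * (q / l)) *
            (bwzMod hl q₀ f : M → ℂ) (mk ⟨p.1, p.2.1, p.2.2⟩) ∧
      (bwzMod hl q₀ f : M → ℂ) (rmul ⟨0, q / l, 0⟩ (mk ⟨p.1, p.2.1, p.2.2⟩)) =
        Complex.exp (2 * Real.pi * Complex.I * q * p.1) *
          (bwzMod hl ((q₀ - q : ℤ) : ZMod l.natAbs) f : M → ℂ) (mk ⟨p.1, p.2.1, p.2.2⟩) := by
  rw [bwzMod_intCast, bwzMod_intCast]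
  filter_upwards [ae_toM (ae_bwzIso_translate hl q₀ q f)] with ⟨a, b, c⟩ h
  simp only [chi_mk, chiLift_eq, Heis.ofProd, expo_zero, one_mul, mul_one] at h
  rw [exp_neg_eq_expo, exp_div_eq_expo]
  exact h

end HeisNil

end

theorem theorem2p1 :
    -- the orthogonal decomposition of `L²(M)` into central Fourier modes, stable under `R`,
    -- whose components are given by Fourier series in the central variable
    IsOrthogonalDecomposition centralMode ⊤ ∧
    (∀ l : ℤ, IsInvariant regRep (centralMode l)) ∧
    (∀ f : L2M, ∃ F : ℤ → L2M,
      (∀ l : ℤ, F l ∈ centralMode l ∧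
        ∀ᵐ p : ℝ × ℝ × ℝ,
          IntervalIntegrable (fun t : ℝ => (f : M → ℂ) (mk ⟨p.1, p.2.1, t⟩)) volume 0 1 ∧
          (F l : M → ℂ) (mk ⟨p.1, p.2.1, p.2.2⟩) =
            Complex.exp (2 * Real.pi * Complex.I * l * p.2.2) *
              ∫ t in (0 : ℝ)..1, (f : M → ℂ) (mk ⟨p.1, p.2.1, t⟩) *
                Complex.exp (-(2 * Real.pi * Complex.I * l * t))) ∧
      HasSum F f) ∧
    -- (1) the zero mode
    ((∀ w : ℤ × ℤ, IsPeriodic (chiLift w) ∧ (∀ x : Heis, chi w (mk x) = chiLift w x) ∧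
        SmoothOnM (chi w)) ∧
      ∃ X : ℤ × ℤ → L2M,
        (∀ w : ℤ × ℤ, (X w : M → ℂ) =ᵐ[muM] chi w) ∧
        IsOrthogonalDecomposition (fun w => Submodule.span ℂ {X w}) (centralMode 0) ∧
        ∀ w : ℤ × ℤ, IsIrreducibleOn regRep (Submodule.span ℂ {X w})) ∧
    ∀ l : ℤ, l ≠ 0 →
      -- (2a) the transform is well defined, smooth, in the mode `l`, and periodic in `q`
      (∀ (q : ℤ) (h : 𝓢(ℝ, ℂ)),
        (∀ x : Heis, Summable (bwzTerm l q h x)) ∧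
        IsPeriodic (bwzLift l q h) ∧
        (∀ x : Heis, bwz l q h (mk x) = bwzLift l q h x) ∧
        SmoothOnM (bwz l q h) ∧
        (∃ hL : MemLp (bwz l q h) 2 muM, hL.toLp ∈ centralMode l) ∧
        ∀ k : ℤ, bwz l (l * k + q) h = bwz l q h) ∧
      -- (2c) the translation formulas
      (∀ (q₀ q : ℤ) (h : 𝓢(ℝ, ℂ)) (a b c : ℝ),
        bwz l q₀ h (rmul ⟨q / l, 0, 0⟩ (mk ⟨a, b, c⟩)) =
          Complex.exp (-(2 * Real.pi * Complex.I * q * b)) *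
            Complex.exp (2 * Real.pi * Complex.I * q₀ * (q / l)) * bwz l q₀ h (mk ⟨a, b, c⟩) ∧
        bwz l q₀ h (rmul ⟨0, q / l, 0⟩ (mk ⟨a, b, c⟩)) =
          Complex.exp (2 * Real.pi * Complex.I * q * a) * bwz l (q₀ - q) h (mk ⟨a, b, c⟩)) ∧
      -- the Schrödinger representation is irreducible
      IsIrreducibleOn (schrodinger l) ⊤ ∧
      -- (2b) the isometric extensions to `L²(ℝ)`, indexed by `ℤ/lℤ`
      ∃ B : ZMod l.natAbs → (L2R →ₗᵢ[ℂ] L2M),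
        (∀ q : ℤ,
          (∀ h : 𝓢(ℝ, ℂ), (B q (h.toLp 2) : M → ℂ) =ᵐ[muM] bwz l q h) ∧
          ∀ T : L2R →L[ℂ] L2M,
            (∀ h : 𝓢(ℝ, ℂ), (T (h.toLp 2) : M → ℂ) =ᵐ[muM] bwz l q h) →
              T = (B q).toContinuousLinearMap) ∧
        (∀ q f, B q f ∈ centralMode l) ∧
        -- (2c) for the extensions
        (∀ (q₀ q : ℤ) (f : L2R), ∀ᵐ p : ℝ × ℝ × ℝ,
          (B q₀ f : M → ℂ) (rmul ⟨q / l, 0, 0⟩ (mk ⟨p.1, p.2.1, p.2.2⟩)) =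
            Complex.exp (-(2 * Real.pi * Complex.I * q * p.2.1)) *
              Complex.exp (2 * Real.pi * Complex.I * q₀ * (q / l)) *
                (B q₀ f : M → ℂ) (mk ⟨p.1, p.2.1, p.2.2⟩) ∧
          (B q₀ f : M → ℂ) (rmul ⟨0, q / l, 0⟩ (mk ⟨p.1, p.2.1, p.2.2⟩)) =
            Complex.exp (2 * Real.pi * Complex.I * q * p.1) *
              (B ((q₀ - q : ℤ) : ZMod l.natAbs) f : M → ℂ) (mk ⟨p.1, p.2.1, p.2.2⟩)) ∧
        -- (3) the ranges decompose the mode `l`, and `B q` intertwines `R` with `π_l`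
        IsOrthogonalDecomposition (fun q => LinearMap.range (B q).toLinearMap)
          (centralMode l) ∧
        (∀ q, IsInvariant regRep (LinearMap.range (B q).toLinearMap)) ∧
        ∀ q g f, B q (schrodinger l g f) = regRep g (B q f) := by
  refine ⟨isOrthogonalDecomposition_centralMode, isInvariant_centralMode,
    fun f => ⟨fun l => centralProj l f,
      fun l => ⟨centralProj_mem l f, ae_central_formula l f⟩, hasSum_centralProj f⟩,
    ⟨fun w => ⟨isPeriodic_chiLift w, chi_mk w, smoothOnM_chi w⟩,
      chiLp, coeFn_chiLp, isOrthogonalDecomposition_chiLp, isIrreducibleOn_chiLp⟩,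
    fun l hl => ⟨fun q h => ⟨summable_bwzTerm hl q h, isPeriodic_bwzLift hl q h, bwz_mk hl q h,
      smoothOnM_bwz hl q h, ⟨memLp_bwz hl q h, bwz_mem_centralMode hl q h⟩,
      fun k => bwz_periodic hl q k h⟩,
      bwz_translate hl, isIrreducibleOn_schrodinger (Int.cast_ne_zero.2 hl), bwzMod hl,
      fun q => ?_, fun q f => bwzIso_mem hl _ f, ae_bwzMod_translate hl,
      isOrthogonalDecomposition_bwzMod hl, isInvariant_range_bwzMod hl,
      fun q g f => bwzIso_schrodinger hl _ g f⟩⟩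
  rw [bwzMod_intCast]
  exact ⟨coeFn_bwzIso_toLp hl q, bwzIso_unique hl q⟩
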